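/- **Theorem (Classification of scalar MLPs and scalar neural ODEs).** Let $d\ge 1$. For $\Psi\in C^k(\mathbb R^d,\mathbb R)$ we say that $\Psi$ is of class $(\mathcal C1)^k$ if $\nabla\Psi(x)\ne 0$ for all $x$; of class $(\mathcal C2)^k$ ($k\ge2$) if $\Psi$ has a critical point and the Hessian is non-singular at every critical point; of class $(\mathcal C3)^k$ ($k\ge2$) if the Hessian is singular at some critical point. *MLPs.* A scalar MLP $\Phi_\theta:\mathbb R^d\to\mathbb R$ is given by $h_0=x$, $h_{l+1}=\widetilde W_l\,\sigma_l(W_lh_l+b_l)+\tilde b_l$ for $0\le l<L$, $\Phi_\theta(x)=h_L$, where $h_l\in\mathbb R^{d_l}$, $d_0=d$, $d_L=1$, $W_l\in\mathbb R^{m_l\times d_l}$, $\widetilde W_l\in\mathbb R^{d_{l+1}\times m_l}$, all dimensions are positive, and $\sigma_l$ acts component-wise through functions $[\sigma_l]_i\in C^k(\mathbb R,\mathbb R)$ that are strictly monotone in the sense that $[\sigma_l]_i'$ vanishes nowhere. The architecture is determined by the sequence of all widths $(e_0,\dots,e_{2L})=(d_0,m_0,d_1,m_1,\dots,m_{L-1},d_L)$: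 it is *non-augmented* if this sequence is monotonically decreasing; *augmented* if there is $M$ with $e_M>e_0$ such that the sequence is monotonically increasing up to $M$ and monotonically decreasing from $M$ on; it has a *bottleneck* if there are $i<B<j$ with $e_i>e_B$ and $e_B<e_j$. The weight space is $\mathbb W=\{(W_0,\widetilde W_0,\dots,W_{L-1},\widetilde W_{L-1})\}$. 1. Every non-augmented MLP with full rank weight matrices, $k\ge 1$, is of class $(\mathcal C1)^k$. 2. For every augmented architecture, $k\ge2$, and all activation functions and biases as above: for all weights in $\mathbb W$ apart from a Lebesgue null set, $\Phi_\theta$ is of class $(\mathcal C1)^k$ or $(\mathcal C2)^k$. 3. MLPs with a bottleneck and full rank weight matrices, $k\ge 2$, can be of all classes: each of them is of class $(\mathcal C1)^k$, $(\mathcal C2)^k$ or $(\mathcal C3)^k$, and for every $d\ge1$ and each of the three classes there is an MLP $\mathbb R^d\to\mathbb R$ with a bottleneck, with full rank weight matrices and with activation functions that are not affine, that belongs to this class. The bottleneck can moreover be found among the layers $h_l$ themselves, i.e. $d_i>d_B$ and $d_B<d_j$ for some $i<B<j$. *Neural ODEs.* Let $m\ge1$, $T>0$, and let $f:[0,T]\times\mathbb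 R^m\to\mathbb R^m$ have partial derivatives with respect to the second variable up to order $k$ that are continuous on $[0,T]\times\mathbb R^m$. Let $W\in\mathbb R^{m\times d}$, $\widetilde W\in\mathbb R^{1\times m}$, $b\in\mathbb R^m$, $\tilde b\in\mathbb R$ be such that for every $x\in\mathbb R^d$ the initial value problem $h'=f(t,h)$, $h(0)=Wx+b$ has a solution on $[0,T]$. The associated scalar neural ODE is $\Phi_\theta(x)=\widetilde Wh(T)+\tilde b$. It is *non-augmented* if $m\le\max\{d,1\}$ and $W,\widetilde W$ have full rank, *augmented* if $m>\max\{d,1\}$ and $W,\widetilde W$ have full rank, and *degenerate* if $W$ or $\widetilde W$ does not have full rank. The weight space is $\mathbb V=\{(W,\widetilde W)\}$. 4. Every non-augmented neural ODE, $k\ge1$, is of class $(\mathcal C1)^k$. 5. Let $k\ge 2$, $m>\max\{d,1\}$, and let $T,f,b,\tilde b$ be given. For all weights in $\mathbb V$ apart from a Lebesgue null set, the neural ODE $\Phi_\theta$, whenever it is defined on all of $\mathbb R^d$, is of class $(\mathcal C1)^k$ or $(\mathcal C2)^k$. 6. Every degenerate neural ODE, $k\ge2$, is of class $(\mathcal C1)^k$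 or $(\mathcal C3)^k$. -/

import Mathlib

open MeasureTheory Set

/-! ### Function classes -/

/-- The Hessian matrix of second partial derivatives of `Ψ` at `x`. -/
noncomputable def hessianMatrix {d : ℕ} (Ψ : EuclideanSpace ℝ (Fin d) → ℝ)
    (x : EuclideanSpace ℝ (Fin d)) : Matrix (Fin d) (Fin d) ℝ :=
  Matrix.of fun i j =>
    iteratedFDeriv ℝ 2 Ψ x ![EuclideanSpace.single i 1, EuclideanSpace.single j 1]

/-- Functions of class `C^k` without critical points. -/
def classC1 (k d : ℕ) : Set (EuclideanSpace ℝ (Fin d) → ℝ) :=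
  {Ψ | ContDiff ℝ k Ψ ∧ ∀ x, gradient Ψ x ≠ 0}

/-- Functions of class `C^k` that have a critical point, and all of whose critical points are
non-degenerate. -/
def classC2 (k d : ℕ) : Set (EuclideanSpace ℝ (Fin d) → ℝ) :=
  {Ψ | ContDiff ℝ k Ψ ∧ (∃ p, gradient Ψ p = 0) ∧
    ∀ q, gradient Ψ q = 0 → (hessianMatrix Ψ q).det ≠ 0}

/-- Functions of class `C^k` that have a degenerate critical point. -/
def classC3 (k d : ℕ) : Set (EuclideanSpace ℝ (Fin d) → ℝ) :=
  {Ψ | ContDiff ℝ k Ψ ∧ ∃ p, gradient Ψ p = 0 ∧ (hessianMatrix Ψ p).det = 0}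

/-- A (rectangular) matrix has full rank. -/
def FullRank {m n : ℕ} (A : Matrix (Fin m) (Fin n) ℝ) : Prop := A.rank = min m n

/-! ### Shapes of sequences of layer widths -/

/-- The widths decrease monotonically. -/
def NonAugmentedWidths {N : ℕ} (w : Fin (N + 1) → ℕ) : Prop := Antitone w

/-- There is a layer `M` of maximal width, wider than the first layer, such that the widths increase
monotonically up to `M` and decrease monotonically from `M` on. -/
def AugmentedWidths {N : ℕ} (w : Fin (N + 1) → ℕ) : Prop :=
  ∃ M, w 0 < w M ∧ MonotoneOn w (Iic M) ∧ AntitoneOn w (Ici M)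

/-- Some layer is narrower than both an earlier and a later layer. -/
def BottleneckWidths {N : ℕ} (w : Fin (N + 1) → ℕ) : Prop :=
  ∃ i b j, i < b ∧ b < j ∧ w b < w i ∧ w b < w j

/-! ### Multilayer perceptrons -/

/-- The architecture of a scalar multilayer perceptron: `width l` is the dimension of the layer `h_l`,
and `inner l` is the number of rows of `W_l`, i.e. the dimension of `σ_l (W_l h_l + b_l)`. -/
structure MLPArch where
  L : ℕ
  width : Fin (L + 1) → ℕ
  inner : Fin L → ℕ
  width_pos : ∀ l, 0 < width l
  inner_pos : ∀ l, 0 < inner l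
  width_last : width (Fin.last L) = 1

namespace MLPArch

/-- The widths of all layers, in the order in which they are passed:
`width 0, inner 0, width 1, inner 1, …, inner (L - 1), width L`. -/
def allWidths (A : MLPArch) : Fin (2 * A.L + 1) → ℕ := fun j =>
  if h : j.1 % 2 = 0 then A.width ⟨j.1 / 2, by omega⟩ else A.inner ⟨j.1 / 2, by omega⟩

def IsNonAugmented (A : MLPArch) : Prop := NonAugmentedWidths A.allWidths

def IsAugmented (A : MLPArch) : Prop := AugmentedWidths A.allWidths

def IsBottleneck (A : MLPArch) : Prop := BottleneckWidths A.allWidths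

/-- The weight space: the pairs `(W_l, W̃_l)` of matrices, `l = 0, …, L - 1`, given by their entries.
Its `volume` is the Lebesgue measure. -/
abbrev Weights (A : MLPArch) : Type :=
  ∀ l : Fin A.L, (Fin (A.inner l) → Fin (A.width l.castSucc) → ℝ) ×
    (Fin (A.width l.succ) → Fin (A.inner l) → ℝ)

/-- All weight matrices have full rank. -/
def Weights.IsFullRank {A : MLPArch} (θ : A.Weights) : Prop :=
  ∀ l, FullRank (Matrix.of (θ l).1) ∧ FullRank (Matrix.of (θ l).2)

/-- The component-wise activation functions `[σ_l]_i` and the biases `b_l`, `b̃_l`. -/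
structure Params (A : MLPArch) where
  act : ∀ l : Fin A.L, Fin (A.inner l) → ℝ → ℝ
  bias : ∀ l : Fin A.L, Fin (A.inner l) → ℝ
  outBias : ∀ l : Fin A.L, Fin (A.width l.succ) → ℝ

/-- All activation functions are of class `C^k` and strictly monotone, in the sense that the derivative
vanishes nowhere (used for `1 ≤ k`). -/
def Params.IsAdmissible {A : MLPArch} (P : A.Params) (k : ℕ) : Prop :=
  ∀ l i, ContDiff ℝ k (P.act l i) ∧ ∀ s, deriv (P.act l i) s ≠ 0

/-- No activation function is affine. -/
def Params.IsNonlinear {A : MLPArch} (P : A.Params) : Prop :=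
  ∀ l i, ¬ ∃ a c : ℝ, ∀ s, P.act l i s = a * s + c

/-- The layers `h_0 = x`, `h_{l+1} = W̃_l σ_l(W_l h_l + b_l) + b̃_l`. -/
noncomputable def layer (A : MLPArch) (P : A.Params) (θ : A.Weights) (x : Fin (A.width 0) → ℝ) :
    ∀ l : Fin (A.L + 1), Fin (A.width l) → ℝ :=
  Fin.induction (motive := fun l => Fin (A.width l) → ℝ) x fun l h =>
    (Matrix.of (θ l).2).mulVec
      (fun i => P.act l i (((Matrix.of (θ l).1).mulVec h + P.bias l) i)) + P.outBias l

/-- The input-output map of a scalar multilayer perceptron. -/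
noncomputable def map (A : MLPArch) (P : A.Params) (θ : A.Weights) :
    EuclideanSpace ℝ (Fin (A.width 0)) → ℝ := fun x =>
  A.layer P θ x.ofLp (Fin.last A.L) ⟨0, A.width_pos _⟩

end MLPArch

/-! ### Neural ODEs -/

/-- `f ∈ C^{0,k}([0,T] × ℝ^m, ℝ^m)`: the partial derivatives of `f` with respect to the second variable
up to order `k` exist and are continuous on `[0,T] × ℝ^m`. -/
def IsC0kVectorField {m : ℕ} (k : ℕ) (T : ℝ) (f : ℝ → (Fin m → ℝ) → (Fin m → ℝ)) : Prop :=
  (∀ t ∈ Icc 0 T, ContDiff ℝ k (f t)) ∧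
    ∀ j ≤ k, ContinuousOn (fun p : ℝ × (Fin m → ℝ) => iteratedFDeriv ℝ j (f p.1) p.2)
      (Icc 0 T ×ˢ univ)

/-- `Φ` is the input-output map of the scalar neural ODE with vector field `f` and affine layers
`λ(x) = W x + b`, `λ̃(y) = W̃ y + b̃`: for every input `x` there is a solution `h x` of
`h' = f(t, h)`, `h(0) = λ(x)` on `[0,T]`, and `Φ(x) = λ̃(h(T))`. -/
def IsNeuralODEMap {d m : ℕ} (T : ℝ) (f : ℝ → (Fin m → ℝ) → (Fin m → ℝ))
    (W : Matrix (Fin m) (Fin d) ℝ) (b : Fin m → ℝ)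
    (W' : Matrix (Fin 1) (Fin m) ℝ) (b' : Fin 1 → ℝ)
    (Φ : EuclideanSpace ℝ (Fin d) → ℝ) : Prop :=
  ∃ h : EuclideanSpace ℝ (Fin d) → ℝ → (Fin m → ℝ), ∀ x,
    h x 0 = W.mulVec x.ofLp + b ∧
    (∀ t ∈ Icc 0 T, HasDerivWithinAt (h x) (f t (h x t)) (Icc 0 T) t) ∧
    Φ x = (W'.mulVec (h x T) + b') 0

/-! ### Matrices of full rank -/

/-! Everything is read off from the tangent vector `h_l'(x) v`, which passes through `W_l`, the
invertible diagonal matrix of the derivatives `σ_l'`, and `W̃_l` in turn. If the widths decrease,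
full rank makes all these maps surjective, so the differential of the scalar output is never zero.

For augmented architectures, parametric transversality is applied to `H (θ, x) = d_x Φ_θ`. Where `H`
vanishes and is regular, its zero set is locally a manifold of the dimension of the weight space.
The weights with a degenerate critical point there are critical values of the projection of this
manifold to the weight space, hence a null set by Sard's theorem in equal dimensions, which needs
only one derivative of `H` (`measure_image_fst_foldSet`, `ae_nondegenerate_of_transverse`).
Regularity comes from following a tangent vector `v ≠ 0` through the layers: injective matrices keep
it nonzero up to the widest layer. If a later matrix kills it, varying that matrix moves the image
in every direction, and the remaining maps, being surjective, preserve this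
(`tangent_ne_zero_or_vanishesTransversely`). Almost all weights have full rank.

The three classes exhaust the `C^k` functions. With a bottleneck all three occur: the first layer
can form `∑ (σ (x i) + τ (x i))` with `σ`, `τ` monotone but `σ + τ` not, and the remaining layers
apply a function with nonvanishing derivative.

A neural ODE is the time-`T` flow between two affine maps. The implicit function theorem for the
integral equation on `C([0,T], E)` shows that the flow is `C^k`, and backward uniqueness for the
variational equation shows that its differential is injective (`exists_contDiffAt_flow`). The
arguments for MLPs then carry over, and transversality is obtained from `W̃` alone. In the
degenerate case `Φ` is constant along some direction, which lies in the kernel of every Hessian. -/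

theorem FullRank.mulVec_injective {m n : ℕ} {A : Matrix (Fin m) (Fin n) ℝ} (hA : FullRank A)
    (h : n ≤ m) : Function.Injective A.mulVec := by
  have hr : Module.finrank ℝ (LinearMap.range A.mulVecLin) = n := by
    have h1 : A.rank = n := hA.trans (min_eq_right h)
    exact h1
  have hs := A.mulVecLin.finrank_range_add_finrank_ker
  rw [hr, Module.finrank_fin_fun] at hs
  have hk : LinearMap.ker A.mulVecLin = ⊥ := Submodule.finrank_eq_zero.1 (by omega)
  exact LinearMap.ker_eq_bot.1 hk

theorem FullRank.mulVec_surjective {m n : ℕ} {A : Matrix (Fin m) (Fin n) ℝ} (hA : FullRank A)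
    (h : m ≤ n) : Function.Surjective A.mulVec := by
  have hr : Module.finrank ℝ (LinearMap.range A.mulVecLin) = m := by
    have h1 : A.rank = m := hA.trans (min_eq_left h)
    exact h1
  have : LinearMap.range A.mulVecLin = ⊤ :=
    Submodule.eq_top_of_finrank_eq (by rw [hr, Module.finrank_fin_fun])
  exact LinearMap.range_eq_top.1 this

theorem exists_mulVec_eq_zero_of_not_fullRank {m n : ℕ} {A : Matrix (Fin m) (Fin n) ℝ}
    (hA : ¬ FullRank A) : ∃ v, v ≠ 0 ∧ A.mulVec v = 0 := by
  have h1 : A.rank < n := lt_of_le_of_ne A.rank_le_width fun h => hA <| by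
    have := A.rank_le_height
    unfold FullRank
    omega
  have hs := A.mulVecLin.finrank_range_add_finrank_ker
  rw [Module.finrank_fin_fun] at hs
  have h2 : Module.finrank ℝ (LinearMap.range A.mulVecLin) < n := h1
  have hk : LinearMap.ker A.mulVecLin ≠ ⊥ := fun h => by
    rw [h, finrank_bot] at hs
    omega
  obtain ⟨v, hv, hv0⟩ := Submodule.exists_mem_ne_zero_of_ne_bot hk
  exact ⟨v, hv0, hv⟩

theorem FullRank.of_det_submatrix_ne_zero {m n : ℕ} (A : Matrix (Fin m) (Fin n) ℝ)
    (h : (A.submatrix (Fin.castLE (min_le_left m n)) (Fin.castLE (min_le_right m n))).det ≠ 0) :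
    FullRank A := by
  have h1 := Matrix.rank_of_det_ne_zero h
  have h2 := A.rank_submatrix_le (Fin.castLE (min_le_left m n)) (Fin.castLE (min_le_right m n))
  have h3 := A.rank_le_height
  have h4 := A.rank_le_width
  rw [h1, Fintype.card_fin] at h2
  unfold FullRank
  omega

theorem FullRank.of_mulVec_injective {m n : ℕ} {A : Matrix (Fin m) (Fin n) ℝ} (h : n ≤ m)
    (hA : Function.Injective A.mulVec) : FullRank A := by
  have hs := A.mulVecLin.finrank_range_add_finrank_ker
  rw [LinearMap.ker_eq_bot.2 hA, finrank_bot, Module.finrank_fin_fun] at hs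
  exact (show A.rank = n from hs).trans (min_eq_right h).symm

theorem FullRank.of_mulVec_surjective {m n : ℕ} {A : Matrix (Fin m) (Fin n) ℝ} (h : m ≤ n)
    (hA : Function.Surjective A.mulVec) : FullRank A := by
  have hr : LinearMap.range A.mulVecLin = ⊤ := LinearMap.range_eq_top.2 hA
  have : A.rank = m := by
    rw [Matrix.rank, hr, finrank_top, Module.finrank_fin_fun]
  exact this.trans (min_eq_left h).symm

/-- Almost every matrix has full rank. -/
theorem ae_fullRank (m n : ℕ) : ∀ᵐ A : Fin m → Fin n → ℝ, FullRank (Matrix.of A) := by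
  let f : Fin (min m n) → Fin m := Fin.castLE (min_le_left m n)
  let g : Fin (min m n) → Fin n := Fin.castLE (min_le_right m n)
  let B : Fin m → Fin n → ℝ := fun i j => if i.1 = j.1 then 1 else 0
  have hB : (Matrix.of B).submatrix f g = 1 := by
    ext i j
    simp [B, f, g, Matrix.one_apply, Fin.ext_iff]
  let s : Set (Fin m → Fin n → ℝ) := {A | ((Matrix.of A).submatrix f g).det ≠ 0}
  have hs : IsOpen s := by
    refine isOpen_ne_fun ?_ continuous_const
    refine Continuous.matrix_det ?_
    refine continuous_matrix fun i j => ?_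
    exact (continuous_apply (g j)).comp (continuous_apply (f i))
  have key : ∀ᵐ A : Fin m → Fin n → ℝ, A ∈ s := by
    -- By Fubini it suffices that each line `A + t • B` meets the complement in a null set. The
    -- leading block of `B` is the identity, so along the line the minor is the characteristic
    -- polynomial of `-C` at `t`, with finitely many roots.
    refine ae_mem_of_ae_add_linearMap_mem (LinearMap.toSpanSingleton ℝ _ B) volume volume
      hs.measurableSet fun A => ?_
    let C := (Matrix.of A).submatrix f g
    have hfin : {t : ℝ | (-C).charpoly.IsRoot t}.Finite :=
      Polynomial.finite_setOfPred_isRoot (Matrix.charpoly_monic _).ne_zero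
    refine measure_mono_null (fun t ht => ?_) (hfin.measure_zero volume)
    simp only [mem_compl_iff, mem_ofPred_eq, s, LinearMap.toSpanSingleton_apply, not_not] at ht ⊢
    have : (Matrix.of (A + t • B)).submatrix f g = t • 1 - (-C) := by
      rw [← hB]
      ext i j
      simp [C, add_comm]
    rw [this] at ht
    rw [Polynomial.IsRoot.def, Matrix.eval_charpoly, ← ht]
    congr 1
    ext i j
    simp [Matrix.scalar_apply, Matrix.one_apply, Matrix.diagonal_apply]
  filter_upwards [key] with A hA
  exact FullRank.of_det_submatrix_ne_zero _ hA

namespace MLPArch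

theorem Weights.ae_isFullRank (A : MLPArch) : ∀ᵐ θ : A.Weights, θ.IsFullRank := by
  refine (ae_all_iff).2 fun l => ?_
  have h1 : ∀ᵐ p : (Fin (A.inner l) → Fin (A.width l.castSucc) → ℝ) ×
      (Fin (A.width l.succ) → Fin (A.inner l) → ℝ),
      FullRank (Matrix.of p.1) ∧ FullRank (Matrix.of p.2) :=
    (Measure.quasiMeasurePreserving_fst.ae (ae_fullRank _ _)).and
      (Measure.quasiMeasurePreserving_snd.ae (ae_fullRank _ _))
  exact (Measure.quasiMeasurePreserving_eval (fun l : Fin A.L => (volume :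
    Measure ((Fin (A.inner l) → Fin (A.width l.castSucc) → ℝ) ×
      (Fin (A.width l.succ) → Fin (A.inner l) → ℝ)))) l).ae h1

end MLPArch

/-! ### Parametric transversality -/

section Transversality

variable {P E F : Type*} [NormedAddCommGroup P] [NormedSpace ℝ P] [FiniteDimensional ℝ P]
  [NormedAddCommGroup E] [NormedSpace ℝ E] [FiniteDimensional ℝ E]
  [NormedAddCommGroup F] [NormedSpace ℝ F] [FiniteDimensional ℝ F]

open Module Filter Topology

/-- The zeros of `H` at which `H` is regular, but its partial derivative in the second variable is
singular. -/
def foldSet (H : P × E → F) : Set (P × E) :=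
  {z | ContDiffAt ℝ 1 H z ∧ H z = 0 ∧ Function.Surjective (fderiv ℝ H z) ∧
    ∃ v : E, v ≠ 0 ∧ fderiv ℝ H z (0, v) = 0}

/-- As `dim E = dim F`, the kernel of `L` has the dimension of `P`. A projection onto the kernel,
followed by an identification with `P`, supplies the missing coordinates. With `L` the differential
of `H`, this yields a chart that straightens the zero set of `H`. -/
theorem exists_equiv_prod_of_surjective (hd : finrank ℝ E = finrank ℝ F) (L : P × E →L[ℝ] F)
    (hL : Function.Surjective L) :
    ∃ (Λ : P × E →L[ℝ] P) (e : (P × E) ≃L[ℝ] F × P), (e : P × E →L[ℝ] F × P) = L.prod Λ := by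
  obtain ⟨p, hp⟩ := L.ker_closedComplemented_of_finiteDimensional_range
  have h1 := (L : P × E →ₗ[ℝ] F).finrank_range_add_finrank_ker
  rw [LinearMap.range_eq_top.2 hL, finrank_top, finrank_prod] at h1
  have h2 : finrank ℝ (LinearMap.ker (L : P × E →ₗ[ℝ] F)) = finrank ℝ P := by omega
  let N : LinearMap.ker (L : P × E →ₗ[ℝ] F) ≃ₗ[ℝ] P := LinearEquiv.ofFinrankEq _ _ h2
  let Λ : P × E →L[ℝ] P := (LinearMap.toContinuousLinearMap (N : _ →ₗ[ℝ] P)).comp p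
  have hinj : Function.Injective ((L.prod Λ : P × E →L[ℝ] F × P) : P × E →ₗ[ℝ] F × P) := by
    refine (injective_iff_map_eq_zero _).2 fun z hz => ?_
    have hz' : (L z, Λ z) = 0 := hz
    have hz1 : L z = 0 := congrArg Prod.fst hz'
    have hz2 : N (p z) = 0 := congrArg Prod.snd hz'
    have hz3 : p z = 0 := by simpa using hz2
    have := hp ⟨z, hz1⟩
    rw [show p ((⟨z, hz1⟩ : LinearMap.ker (L : P × E →ₗ[ℝ] F)) : P × E) = p z from rfl, hz3] at this
    exact (congrArg Subtype.val this).symm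
  let e := (LinearEquiv.ofInjectiveOfFinrankEq _ hinj (by
    rw [finrank_prod, finrank_prod]; omega)).toContinuousLinearEquiv
  refine ⟨Λ, e, ?_⟩
  ext z <;> rfl

variable [MeasurableSpace P] [BorelSpace P]

/-- In the chart `G = (H, Λ)` the zero set of `H` is the slice `{0} × P`, and its projection to the
parameters becomes a self-map `κ` of `P`. At a fold point the vector `(0, v)` is tangent to the zero
set and killed by the projection, so `κ` has singular derivative there. -/
theorem exists_nhds_image_fst_foldSet_null (μ : Measure P) [μ.IsAddHaarMeasure]
    (hd : finrank ℝ E = finrank ℝ F) (H : P × E → F) {z₀ : P × E} (hz₀ : z₀ ∈ foldSet H) :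
    ∃ U ∈ 𝓝 z₀, μ (Prod.fst '' (foldSet H ∩ U)) = 0 := by
  obtain ⟨hc, -, hsurj, -⟩ := hz₀
  obtain ⟨Λ, e, he⟩ := exists_equiv_prod_of_surjective hd _ hsurj
  let G : P × E → F × P := fun z => (H z, Λ z)
  have hGc : ContDiffAt ℝ 1 G z₀ := hc.prodMk Λ.contDiff.contDiffAt
  have hG' : HasFDerivAt G (e : P × E →L[ℝ] F × P) z₀ := by
    rw [he]
    exact (hc.differentiableAt one_ne_zero).hasFDerivAt.prodMk Λ.hasFDerivAt
  have hψ := hGc.to_localInverse hG' one_ne_zero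
  set ψ := hGc.localInverse hG' one_ne_zero
  have hleft : ∀ᶠ z in 𝓝 z₀, ψ (G z) = z :=
    (hGc.hasStrictFDerivAt' hG' one_ne_zero).eventually_left_inverse
  have hd' : ∀ᶠ z in 𝓝 z₀, DifferentiableAt ℝ ψ (G z) :=
    hGc.continuousAt.eventually
      ((hψ.eventually (by simp)).mono fun y hy => hy.differentiableAt one_ne_zero)
  -- The identity `ψ ∘ G = id` is required in a neighbourhood of each point of `U`, so that it can
  -- be differentiated there.
  refine ⟨_, hleft.eventually_nhds.and hd', ?_⟩
  set U := {z | (∀ᶠ z in 𝓝 z, ψ (G z) = z) ∧ DifferentiableAt ℝ ψ (G z)}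
  let κ : P → P := fun q => (ψ (0, q)).1
  let κ' : P → P →L[ℝ] P := fun q =>
    (ContinuousLinearMap.fst ℝ P E).comp ((fderiv ℝ ψ (0, q)).comp (ContinuousLinearMap.inr ℝ F P))
  let s : Set P := Λ '' (foldSet H ∩ U)
  have key : μ (κ '' s) = 0 := by
    refine addHaar_image_eq_zero_of_det_fderivWithin_eq_zero μ (f' := κ') ?_ ?_
    · rintro q ⟨z, ⟨⟨-, hz, -⟩, hU⟩, rfl⟩
      have h1 : DifferentiableAt ℝ ψ (0, Λ z) := by
        have := hU.2
        rwa [show G z = (0, Λ z) by simp [G, hz]] at this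
      exact (hasFDerivAt_fst.comp (Λ z) (h1.hasFDerivAt.comp (Λ z)
        (hasFDerivAt_prodMk_right (0 : F) (Λ z)))).hasFDerivWithinAt
    · rintro q ⟨z, ⟨⟨hcz, hz, -, v, hv0, hv⟩, hU⟩, rfl⟩
      have hGz : G z = (0, Λ z) := by simp [G, hz]
      have hGd : HasFDerivAt G ((fderiv ℝ H z).prod Λ) z :=
        (hcz.differentiableAt one_ne_zero).hasFDerivAt.prodMk Λ.hasFDerivAt
      have hcomp : HasFDerivAt (fun z => ψ (G z)) _ z := hU.2.hasFDerivAt.comp z hGd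
      have hid := hcomp.unique ((hasFDerivAt_id z).congr_of_eventuallyEq hU.1)
      -- Differentiating `ψ ∘ G = id` in the direction `(0, v)` shows that the derivative of `ψ`
      -- sends `(0, Λ (0, v))` to `(0, v)`. Hence `Λ (0, v)` is nonzero and lies in the kernel of
      -- `κ'`.
      have h2 := DFunLike.congr_fun hid (0, v)
      simp only [ContinuousLinearMap.comp_apply, ContinuousLinearMap.prod_apply, hv, hGz,
        ContinuousLinearMap.id_apply] at h2
      have hk : κ' (Λ z) (Λ (0, v)) = 0 := by
        simp [κ', h2]
      have hne : Λ (0, v) ≠ 0 := fun h0 => hv0 (by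
        rw [h0, show ((0 : F), (0 : P)) = 0 from rfl, map_zero] at h2
        exact (congrArg Prod.snd h2).symm)
      by_contra hdet
      have := LinearMap.ker_eq_bot.1 (not_not.1 (mt LinearMap.det_eq_zero_iff_ker_ne_bot.2 hdet))
      exact hne (this (hk.trans (map_zero _).symm))
  refine measure_mono_null ?_ key
  rintro _ ⟨z, hz, rfl⟩
  refine ⟨Λ z, ⟨z, hz, rfl⟩, ?_⟩
  have h1 := hz.2.1.self_of_nhds
  simp only [G, hz.1.2.1] at h1
  simp only [κ, h1]

/-- By the Lindelöf property, countably many of the local neighbourhoods cover the fold set. -/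
theorem measure_image_fst_foldSet (μ : Measure P) [μ.IsAddHaarMeasure]
    (hd : finrank ℝ E = finrank ℝ F) (H : P × E → F) : μ (Prod.fst '' foldSet H) = 0 := by
  choose! U hU hμ using fun z (hz : z ∈ foldSet H) =>
    exists_nhds_image_fst_foldSet_null μ hd H hz
  obtain ⟨t, hts, htc, ht⟩ := TopologicalSpace.countable_cover_nhdsWithin
    (s := foldSet H) fun z hz => mem_nhdsWithin_of_mem_nhds (hU z hz)
  refine measure_mono_null (t := ⋃ z ∈ t, Prod.fst '' (foldSet H ∩ U z)) ?_
    ((measure_biUnion_null_iff htc).2 fun z hz => hμ z (hts hz))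
  rintro _ ⟨z, hz, rfl⟩
  obtain ⟨w, hw, hzw⟩ := mem_iUnion₂.1 (ht hz)
  exact mem_iUnion₂.2 ⟨w, hw, z, ⟨hz, hzw⟩, rfl⟩

theorem HasFDerivAt.hasDerivAt_line_fst {P E F : Type*} [NormedAddCommGroup P] [NormedSpace ℝ P]
    [NormedAddCommGroup E] [NormedSpace ℝ E] [NormedAddCommGroup F] [NormedSpace ℝ F]
    {H : P × E → F} {L : P × E →L[ℝ] F} {θ : P} {x : E} (hH : HasFDerivAt H L (θ, x)) (δ : P) :
    HasDerivAt (fun t : ℝ => H (θ + t • δ, x)) (L (δ, 0)) 0 := by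
  have h1 : HasDerivAt (fun t : ℝ => ((θ + t • δ, x) : P × E)) (δ, 0) 0 := by
    have := ((hasDerivAt_id (0 : ℝ)).smul_const δ).const_add θ
    simpa using this.prodMk (hasDerivAt_const (0 : ℝ) x)
  have h2 : HasFDerivAt H L (θ + (0 : ℝ) • δ, x) := by simpa using hH
  exact h2.comp_hasDerivAt (0 : ℝ) h1

/-- For almost every parameter `θ`, the critical points of `G θ` at which the differential can be
perturbed in every direction by varying `θ` are non-degenerate. -/
theorem ae_nondegenerate_of_transverse (μ : Measure P) [μ.IsAddHaarMeasure] (G : P → E → ℝ) :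
    ∀ᵐ θ ∂μ, ∀ x, ContDiffAt ℝ 2 (Function.uncurry G) (θ, x) → fderiv ℝ (G θ) x = 0 →
      (∀ v, v ≠ 0 → ∃ δ w, w ≠ 0 ∧ HasDerivAt (fun t : ℝ => fderiv ℝ (G (θ + t • δ)) x v) w 0) →
      ∀ v, v ≠ 0 → fderiv ℝ (fderiv ℝ (G θ)) x v ≠ 0 := by
  let H : P × E → (E →L[ℝ] ℝ) := fun z => fderiv ℝ (G z.1) z.2
  have hd : finrank ℝ E = finrank ℝ (E →L[ℝ] ℝ) := by
    rw [← (LinearMap.toContinuousLinearMap (𝕜 := ℝ) (E := E) (F' := ℝ)).finrank_eq]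
    exact Subspace.dual_finrank_eq.symm
  refine measure_mono_null ?_ (measure_image_fst_foldSet μ hd H)
  intro θ hθ
  simp only [mem_compl_iff, mem_ofPred_eq, not_forall, not_not] at hθ
  obtain ⟨x, hc, hx, htr, v, hv0, hv⟩ := hθ
  have hH : ContDiffAt ℝ 1 H (θ, x) := by
    refine ContDiffAt.fderiv (n := 2) (f := fun z : P × E => G z.1) (g := Prod.snd) ?_
      contDiffAt_snd (by norm_num)
    exact hc.comp ((θ, x), x) (f := fun q : (P × E) × E => (q.1.1, q.2))
      (contDiffAt_fst.fst.prodMk contDiffAt_snd)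
  have hHd := (hH.differentiableAt one_ne_zero).hasFDerivAt
  refine ⟨(θ, x), ⟨hH, hx, ?_, v, hv0, ?_⟩, rfl⟩
  · have htr' : ∀ v, v ≠ 0 → ∃ δ, fderiv ℝ H (θ, x) (δ, 0) v ≠ 0 := by
      intro v hv
      obtain ⟨δ, w, hw, hδ⟩ := htr v hv
      refine ⟨δ, ?_⟩
      have h3 := hHd.hasDerivAt_line_fst δ
      have h4 : HasDerivAt (fun t : ℝ => H (θ + t • δ, x) v) (fderiv ℝ H (θ, x) (δ, 0) v) 0 := by
        simpa using h3.clm_apply (hasDerivAt_const (0 : ℝ) v)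
      rwa [h4.unique hδ]
    rw [← ContinuousLinearMap.coe_coe, ← LinearMap.range_eq_top]
    -- A proper range lies in the kernel of a nonzero functional on the dual of `E`. By reflexivity
    -- this is evaluation at some `u ≠ 0`, and the differential could not be perturbed in the
    -- direction `u`.
    by_contra hne
    obtain ⟨φ, hφ0, hφ⟩ := Submodule.exists_le_ker_of_lt_top _ (lt_top_iff_ne_top.2 hne)
    let Φ : Module.Dual ℝ (Module.Dual ℝ E) :=
      φ.comp (LinearMap.toContinuousLinearMap (𝕜 := ℝ) (E := E) (F' := ℝ)).toLinearMap
    obtain ⟨u, hu⟩ := (Module.evalEquiv ℝ E).surjective Φ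
    have hev : ∀ L : E →L[ℝ] ℝ, φ L = L u := by
      intro L
      have := LinearMap.congr_fun hu (L : E →ₗ[ℝ] ℝ)
      simp only [Module.evalEquiv_apply] at this
      exact this.symm
    have hu0 : u ≠ 0 := fun h0 => hφ0 (by ext L; rw [hev, h0]; simp)
    obtain ⟨δ, hδ⟩ := htr' u hu0
    exact hδ ((hev _).symm.trans (hφ ⟨(δ, 0), rfl⟩))
  · have h1 := hHd.comp x (hasFDerivAt_prodMk_right θ x)
    have h2 : fderiv ℝ (fderiv ℝ (G θ)) x = _ := h1.fderiv
    rw [h2] at hv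
    simpa using hv

end Transversality

/-! ### Perturbing matrix-vector products -/

section Perturb

variable {X : Type*} [NormedAddCommGroup X] [NormedSpace ℝ X]

/-- `p` vanishes at `θ`, and its directional derivatives at `θ` take every value. -/
def VanishesTransversely {n : ℕ} (p : X → Fin n → ℝ) (θ : X) : Prop :=
  p θ = 0 ∧ ∀ w, ∃ δ, HasDerivAt (fun t : ℝ => p (θ + t • δ)) w 0

/-- In the product rule the derivative of `W` is applied to `p θ = 0` and drops out. Only `W θ`
applied to the derivative of `p` remains, and `W θ` is surjective. -/
theorem VanishesTransversely.mulVec {m n : ℕ} {p : X → Fin n → ℝ} {θ : X}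
    (hp : VanishesTransversely p θ) {W D : X → Matrix (Fin m) (Fin n) ℝ}
    (hW : ∀ δ (t : ℝ), W (θ + t • δ) = W θ + t • D δ) (hs : Function.Surjective (W θ).mulVec) :
    VanishesTransversely (fun θ => (W θ).mulVec (p θ)) θ := by
  refine ⟨by simp [hp.1], fun w => ?_⟩
  obtain ⟨u, rfl⟩ := hs w
  obtain ⟨δ, hδ⟩ := hp.2 u
  refine ⟨δ, hasDerivAt_pi.2 fun i => ?_⟩
  simp only [hW, Matrix.mulVec, dotProduct, Matrix.add_apply, Matrix.smul_apply, smul_eq_mul]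
  refine HasDerivAt.fun_sum fun j _ => ?_
  have h1 : HasDerivAt (fun t : ℝ => W θ i j + t * D δ i j) (1 * D δ i j) 0 :=
    ((hasDerivAt_id (0 : ℝ)).mul_const _).const_add _
  have h2 := h1.fun_mul (hasDerivAt_pi.1 hδ j)
  simpa [hp.1] using h2

/-- Again the term with the derivative of `a` carries the factor `p θ = 0`; prescribed values are
reached after division by `a θ i`. -/
theorem VanishesTransversely.mul {n : ℕ} {p a : X → Fin n → ℝ} {θ : X}
    (hp : VanishesTransversely p θ) (ha : ∀ i, a θ i ≠ 0)
    (had : ∀ δ i, DifferentiableAt ℝ (fun t : ℝ => a (θ + t • δ) i) 0) :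
    VanishesTransversely (fun θ i => a θ i * p θ i) θ := by
  refine ⟨by ext i; simp [hp.1], fun w => ?_⟩
  obtain ⟨δ, hδ⟩ := hp.2 fun i => (a θ i)⁻¹ * w i
  refine ⟨δ, hasDerivAt_pi.2 fun i => ?_⟩
  have h2 := (had δ i).hasDerivAt.fun_mul (hasDerivAt_pi.1 hδ i)
  simpa [hp.1, ha i] using h2

/-- This is where transversality originates: a nonzero vector is sent to any prescribed vector by a
suitable matrix, and the matrix can be varied with the vector held fixed. -/
theorem vanishesTransversely_mulVec_of_ne_zero {m n : ℕ} {p : X → Fin n → ℝ} {θ : X}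
    (hp : p θ ≠ 0) {W : X → Matrix (Fin m) (Fin n) ℝ} (h0 : (W θ).mulVec (p θ) = 0)
    (hW : ∀ B, ∃ δ, ∀ t : ℝ, W (θ + t • δ) = W θ + t • B ∧ p (θ + t • δ) = p θ) :
    VanishesTransversely (fun θ => (W θ).mulVec (p θ)) θ := by
  refine ⟨h0, fun w => ?_⟩
  obtain ⟨j, hj⟩ := Function.ne_iff.1 hp
  -- This matrix has a single nonzero column, scaled so that it maps `p θ` to `w`.
  obtain ⟨δ, hδ⟩ := hW (Matrix.of fun i k => if k = j then w i * (p θ j)⁻¹ else 0)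
  refine ⟨δ, ?_⟩
  have hBw : (Matrix.of fun i k => if k = j then w i * (p θ j)⁻¹ else 0).mulVec (p θ) = w := by
    ext i
    simp only [Pi.zero_apply] at hj
    simp [Matrix.mulVec, dotProduct, hj]
  have : (fun t : ℝ => (W (θ + t • δ)).mulVec (p (θ + t • δ))) = fun t => t • w := by
    ext1 t
    rw [(hδ t).1, (hδ t).2, Matrix.add_mulVec, h0, zero_add, Matrix.smul_mulVec, hBw]
  rw [this]
  simpa using (hasDerivAt_id (0 : ℝ)).smul_const w

end Perturb

/-! ### Criteria for the function classes -/

theorem gradient_eq_zero_iff {d : ℕ} {Ψ : EuclideanSpace ℝ (Fin d) → ℝ}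
    {x : EuclideanSpace ℝ (Fin d)} : gradient Ψ x = 0 ↔ fderiv ℝ Ψ x = 0 := by
  simp [gradient]

theorem hessianMatrix_mulVec {d : ℕ} (Ψ : EuclideanSpace ℝ (Fin d) → ℝ)
    (x v : EuclideanSpace ℝ (Fin d)) (i : Fin d) :
    (hessianMatrix Ψ x).mulVec v.ofLp i
      = fderiv ℝ (fderiv ℝ Ψ) x (EuclideanSpace.single i 1) v := by
  have hv : v = ∑ j, v j • EuclideanSpace.single j (1 : ℝ) := by
    ext i
    simp [Finset.sum_apply, Pi.single_apply]
  conv_rhs => rw [hv]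
  simp [Matrix.mulVec, dotProduct, hessianMatrix, iteratedFDeriv_two_apply, mul_comm]

theorem fderiv_fderiv_comm {d k : ℕ} (hk : 2 ≤ k) {Ψ : EuclideanSpace ℝ (Fin d) → ℝ}
    (hΨ : ContDiff ℝ k Ψ) (x u v : EuclideanSpace ℝ (Fin d)) :
    fderiv ℝ (fderiv ℝ Ψ) x u v = fderiv ℝ (fderiv ℝ Ψ) x v u := by
  have h2 : ContDiff ℝ 2 Ψ := hΨ.of_le (by exact_mod_cast hk)
  exact (h2.contDiffAt.isSymmSndFDerivAt (by simp)).eq u v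

theorem hessianMatrix_mulVec_eq_zero_iff {d k : ℕ} (hk : 2 ≤ k)
    {Ψ : EuclideanSpace ℝ (Fin d) → ℝ} (hΨ : ContDiff ℝ k Ψ) (x v : EuclideanSpace ℝ (Fin d)) :
    (hessianMatrix Ψ x).mulVec v.ofLp = 0 ↔ fderiv ℝ (fderiv ℝ Ψ) x v = 0 := by
  constructor
  · intro h
    refine ContinuousLinearMap.coe_injective
      ((EuclideanSpace.basisFun (Fin d) ℝ).toBasis.ext fun i => ?_)
    have := congrFun h i
    rw [hessianMatrix_mulVec, fderiv_fderiv_comm hk hΨ] at this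
    simpa using this
  · intro h
    ext i
    rw [hessianMatrix_mulVec, fderiv_fderiv_comm hk hΨ, h]
    simp

theorem det_hessianMatrix_eq_zero_iff {d k : ℕ} (hk : 2 ≤ k)
    {Ψ : EuclideanSpace ℝ (Fin d) → ℝ} (hΨ : ContDiff ℝ k Ψ) (x : EuclideanSpace ℝ (Fin d)) :
    (hessianMatrix Ψ x).det = 0 ↔ ∃ v, v ≠ 0 ∧ fderiv ℝ (fderiv ℝ Ψ) x v = 0 := by
  rw [← Matrix.exists_mulVec_eq_zero_iff]
  constructor
  · rintro ⟨v, hv, h⟩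
    exact ⟨WithLp.toLp 2 v, fun h0 => hv (congrArg WithLp.ofLp h0),
      (hessianMatrix_mulVec_eq_zero_iff hk hΨ x (WithLp.toLp 2 v)).1 h⟩
  · rintro ⟨v, hv, h⟩
    exact ⟨v.ofLp, fun h0 => hv (by ext i; exact congrFun h0 i),
      (hessianMatrix_mulVec_eq_zero_iff hk hΨ x v).2 h⟩

theorem mem_classC1_iff {d k : ℕ} {Ψ : EuclideanSpace ℝ (Fin d) → ℝ} :
    Ψ ∈ classC1 k d ↔ ContDiff ℝ k Ψ ∧ ∀ x, fderiv ℝ Ψ x ≠ 0 := by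
  simp only [classC1, mem_ofPred_eq, ne_eq, gradient_eq_zero_iff]

theorem mem_classC3_of {d k : ℕ} (hk : 2 ≤ k) {Ψ : EuclideanSpace ℝ (Fin d) → ℝ}
    (hΨ : ContDiff ℝ k Ψ) {x v : EuclideanSpace ℝ (Fin d)} (hx : fderiv ℝ Ψ x = 0) (hv : v ≠ 0)
    (h : fderiv ℝ (fderiv ℝ Ψ) x v = 0) : Ψ ∈ classC3 k d :=
  ⟨hΨ, x, gradient_eq_zero_iff.2 hx, (det_hessianMatrix_eq_zero_iff hk hΨ x).2 ⟨v, hv, h⟩⟩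

theorem mem_classC1_union_classC2 {d k : ℕ} (hk : 2 ≤ k) {Ψ : EuclideanSpace ℝ (Fin d) → ℝ}
    (hΨ : ContDiff ℝ k Ψ)
    (h : ∀ x, fderiv ℝ Ψ x = 0 → ∀ v, v ≠ 0 → fderiv ℝ (fderiv ℝ Ψ) x v ≠ 0) :
    Ψ ∈ classC1 k d ∪ classC2 k d := by
  by_cases hc : ∃ p, gradient Ψ p = 0
  · refine Or.inr ⟨hΨ, hc, fun q hq hdet => ?_⟩
    obtain ⟨v, hv, h0⟩ := (det_hessianMatrix_eq_zero_iff hk hΨ q).1 hdet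
    exact h q (gradient_eq_zero_iff.1 hq) v hv h0
  · exact Or.inl ⟨hΨ, not_exists.1 hc⟩

theorem mem_classC1_union_classC2_union_classC3 {d k : ℕ} {Ψ : EuclideanSpace ℝ (Fin d) → ℝ}
    (hΨ : ContDiff ℝ k Ψ) : Ψ ∈ classC1 k d ∪ classC2 k d ∪ classC3 k d := by
  by_cases h3 : ∃ p, gradient Ψ p = 0 ∧ (hessianMatrix Ψ p).det = 0
  · exact Or.inr ⟨hΨ, h3⟩
  · by_cases hc : ∃ p, gradient Ψ p = 0
    · exact Or.inl (Or.inr ⟨hΨ, hc, fun q hq hdet => h3 ⟨q, hq, hdet⟩⟩)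
    · exact Or.inl (Or.inl ⟨hΨ, not_exists.1 hc⟩)

namespace MLPArch

variable {A : MLPArch}

/-- The argument `W_l h_l + b_l` of the activation functions. -/
noncomputable def preact (A : MLPArch) (P : A.Params) (θ : A.Weights) (x : Fin (A.width 0) → ℝ)
    (l : Fin A.L) : Fin (A.inner l) → ℝ :=
  (Matrix.of (θ l).1).mulVec (A.layer P θ x l.castSucc) + P.bias l

theorem layer_succ (P : A.Params) (θ : A.Weights) (x : Fin (A.width 0) → ℝ) (l : Fin A.L) :
    A.layer P θ x l.succ =
      (Matrix.of (θ l).2).mulVec (fun i => P.act l i (A.preact P θ x l i)) + P.outBias l := rfl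

/-- The derivative of the layer `h_l` at `x` in the direction `v`. -/
noncomputable def tangent (A : MLPArch) (P : A.Params) (θ : A.Weights)
    (x v : Fin (A.width 0) → ℝ) : ∀ l : Fin (A.L + 1), Fin (A.width l) → ℝ :=
  Fin.induction (motive := fun l => Fin (A.width l) → ℝ) v fun l p =>
    (Matrix.of (θ l).2).mulVec
      (fun i => deriv (P.act l i) (A.preact P θ x l i) * (Matrix.of (θ l).1).mulVec p i)

theorem tangent_zero (P : A.Params) (θ : A.Weights) (x v : Fin (A.width 0) → ℝ) :
    A.tangent P θ x v 0 = v := rfl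

theorem tangent_succ (P : A.Params) (θ : A.Weights) (x v : Fin (A.width 0) → ℝ) (l : Fin A.L) :
    A.tangent P θ x v l.succ = (Matrix.of (θ l).2).mulVec
      (fun i => deriv (P.act l i) (A.preact P θ x l i) *
        (Matrix.of (θ l).1).mulVec (A.tangent P θ x v l.castSucc) i) := rfl

/-! #### Smoothness -/

theorem contDiff_mulVec {n : WithTop ℕ∞} {X : Type*} [NormedAddCommGroup X] [NormedSpace ℝ X]
    {a b : ℕ} {W : X → Fin a → Fin b → ℝ} {h : X → Fin b → ℝ}
    (hW : ContDiff ℝ n W) (hh : ContDiff ℝ n h) :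
    ContDiff ℝ n fun x => (Matrix.of (W x)).mulVec (h x) := by
  refine contDiff_pi.2 fun i => ?_
  simp only [Matrix.mulVec, dotProduct, Matrix.of_apply]
  refine ContDiff.sum fun j _ => ?_
  exact (contDiff_pi.1 (contDiff_pi.1 hW i) j).mul (contDiff_pi.1 hh j)

theorem contDiff_preact_of_layer {P : A.Params} {n : WithTop ℕ∞} {l : Fin A.L}
    (h : ContDiff ℝ n fun q : A.Weights × (Fin (A.width 0) → ℝ) =>
      A.layer P q.1 q.2 l.castSucc) :
    ContDiff ℝ n fun q : A.Weights × (Fin (A.width 0) → ℝ) => A.preact P q.1 q.2 l := by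
  have h1 : ContDiff ℝ n fun q : A.Weights × (Fin (A.width 0) → ℝ) => (q.1 l).1 :=
    (contDiff_pi.1 contDiff_fst l).fst
  exact (contDiff_mulVec h1 h).add contDiff_const

theorem contDiff_layer {P : A.Params} {k : ℕ} (hP : P.IsAdmissible k) (l : Fin (A.L + 1)) :
    ContDiff ℝ k fun q : A.Weights × (Fin (A.width 0) → ℝ) => A.layer P q.1 q.2 l := by
  induction l using Fin.induction with
  | zero => exact contDiff_snd
  | succ l ih =>
    have h1 : ContDiff ℝ k fun q : A.Weights × (Fin (A.width 0) → ℝ) => (q.1 l).2 :=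
      (contDiff_pi.1 contDiff_fst l).snd
    refine (contDiff_mulVec h1 (contDiff_pi.2 fun i => ?_)).add contDiff_const
    exact (hP l i).1.comp (contDiff_pi.1 (contDiff_preact_of_layer ih) i)

theorem contDiff_preact {P : A.Params} {k : ℕ} (hP : P.IsAdmissible k) (l : Fin A.L) :
    ContDiff ℝ k fun q : A.Weights × (Fin (A.width 0) → ℝ) => A.preact P q.1 q.2 l :=
  contDiff_preact_of_layer (contDiff_layer hP _)

theorem contDiff_map_uncurry {P : A.Params} {k : ℕ} (hP : P.IsAdmissible k) :
    ContDiff ℝ k (Function.uncurry (A.map P)) := by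
  have h : ContDiff ℝ k fun q : A.Weights × EuclideanSpace ℝ (Fin (A.width 0)) =>
      (q.1, q.2.ofLp) := contDiff_fst.prodMk (PiLp.contDiff_ofLp.comp contDiff_snd)
  exact contDiff_pi.1 ((contDiff_layer hP (Fin.last A.L)).comp h) _

theorem contDiff_map {P : A.Params} {k : ℕ} (hP : P.IsAdmissible k) (θ : A.Weights) :
    ContDiff ℝ k (A.map P θ) :=
  (contDiff_map_uncurry hP).comp (contDiff_prodMk_right θ)

/-! #### The differential -/

theorem hasDerivAt_mulVec {a b : ℕ} (W : Matrix (Fin a) (Fin b) ℝ) {h : ℝ → Fin b → ℝ}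
    {h' : Fin b → ℝ} {s : ℝ} (hh : HasDerivAt h h' s) :
    HasDerivAt (fun s => W.mulVec (h s)) (W.mulVec h') s :=
  (LinearMap.toContinuousLinearMap W.mulVecLin).hasFDerivAt.comp_hasDerivAt s hh

theorem hasDerivAt_layer {P : A.Params} {k : ℕ} (hk : 1 ≤ k) (hP : P.IsAdmissible k)
    (θ : A.Weights) {x : ℝ → Fin (A.width 0) → ℝ} {v : Fin (A.width 0) → ℝ} {s : ℝ}
    (hx : HasDerivAt x v s) (l : Fin (A.L + 1)) :
    HasDerivAt (fun s => A.layer P θ (x s) l) (A.tangent P θ (x s) v l) s := by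
  induction l using Fin.induction with
  | zero => exact hx
  | succ l ih =>
    rw [tangent_succ]
    simp only [layer_succ]
    refine (hasDerivAt_mulVec _ (hasDerivAt_pi.2 fun i => ?_)).add_const _
    have h1 : HasDerivAt (fun s => A.preact P θ (x s) l i)
        ((Matrix.of (θ l).1).mulVec (A.tangent P θ (x s) v l.castSucc) i) s :=
      hasDerivAt_pi.1 ((hasDerivAt_mulVec _ ih).add_const _) i
    have h2 : HasDerivAt (P.act l i) (deriv (P.act l i) (A.preact P θ (x s) l i))
        (A.preact P θ (x s) l i) :=
      ((hP l i).1.differentiable (by exact_mod_cast (by omega : k ≠ 0)) _).hasDerivAt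
    exact h2.comp s h1

theorem fderiv_map {P : A.Params} {k : ℕ} (hk : 1 ≤ k) (hP : P.IsAdmissible k)
    (θ : A.Weights) (x v : EuclideanSpace ℝ (Fin (A.width 0))) :
    fderiv ℝ (A.map P θ) x v =
      A.tangent P θ x.ofLp v.ofLp (Fin.last A.L) ⟨0, A.width_pos _⟩ := by
  have hd : HasFDerivAt (A.map P θ) (fderiv ℝ (A.map P θ) x) (x + (0 : ℝ) • v) := by
    rw [zero_smul, add_zero]
    exact ((contDiff_map hP θ).differentiable
      (by exact_mod_cast (by omega : k ≠ 0)) x).hasFDerivAt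
  have h1 : HasDerivAt (fun s : ℝ => x + s • v) v 0 := by
    simpa using ((hasDerivAt_id (0 : ℝ)).smul_const v).const_add x
  have h2 : HasDerivAt (fun s : ℝ => x.ofLp + s • v.ofLp) v.ofLp 0 := by
    simpa using ((hasDerivAt_id (0 : ℝ)).smul_const v.ofLp).const_add x.ofLp
  have h3 := hasDerivAt_pi.1 (hasDerivAt_layer hk hP θ h2 (Fin.last A.L)) ⟨0, A.width_pos _⟩
  simp only [zero_smul, add_zero] at h3
  have h4 : HasDerivAt (fun s : ℝ => A.map P θ (x + s • v)) (fderiv ℝ (A.map P θ) x v) 0 :=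
    HasFDerivAt.comp_hasDerivAt (l := A.map P θ)
      (f := fun s : ℝ => x + s • v) (0 : ℝ) hd h1
  exact h4.unique h3

/-! #### Non-augmented architectures -/

theorem allWidths_even (A : MLPArch) (l : Fin (A.L + 1)) (h : 2 * l.1 < 2 * A.L + 1) :
    A.allWidths ⟨2 * l.1, h⟩ = A.width l := by
  have h1 : 2 * l.1 % 2 = 0 := by omega
  simp only [allWidths, dif_pos h1]
  congr 1
  ext
  simp

theorem allWidths_odd (A : MLPArch) (l : Fin A.L) (h : 2 * l.1 + 1 < 2 * A.L + 1) :
    A.allWidths ⟨2 * l.1 + 1, h⟩ = A.inner l := by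
  have h1 : ¬ (2 * l.1 + 1) % 2 = 0 := by omega
  simp only [allWidths, dif_neg h1]
  congr 1
  ext
  simp
  omega

/-- Each step is a composition of surjections: `W_l` and `W̃_l` do not increase the dimension and
have full rank, and the activations multiply by nonzero factors. -/
theorem tangent_surjective {P : A.Params} {k : ℕ} (hP : P.IsAdmissible k)
    (hA : A.IsNonAugmented) {θ : A.Weights} (hθ : θ.IsFullRank) (x : Fin (A.width 0) → ℝ)
    (l : Fin (A.L + 1)) : Function.Surjective fun v => A.tangent P θ x v l := by
  induction l using Fin.induction with
  | zero => exact Function.surjective_id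
  | succ l ih =>
    intro w
    have hl := l.2
    have e0 := A.allWidths_even l.castSucc (by simp)
    have e1 := A.allWidths_odd l (by omega)
    have e2 := A.allWidths_even l.succ (by simp)
    have h1 : A.inner l ≤ A.width l.castSucc := by
      rw [← e0, ← e1]
      exact hA (by simp)
    have h2 : A.width l.succ ≤ A.inner l := by
      rw [← e1, ← e2]
      exact hA (by simp [Fin.le_def])
    obtain ⟨y, rfl⟩ := (hθ l).2.mulVec_surjective h2 w
    obtain ⟨u, hu⟩ := (hθ l).1.mulVec_surjective h1
      fun i => (deriv (P.act l i) (A.preact P θ x l i))⁻¹ * y i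
    obtain ⟨v, rfl⟩ := ih u
    refine ⟨v, ?_⟩
    simp only [tangent_succ, hu]
    congr 1
    ext i
    simp [(hP l i).2]

theorem map_mem_classC1 {P : A.Params} {k : ℕ} (hk : 1 ≤ k) (hP : P.IsAdmissible k)
    (hA : A.IsNonAugmented) {θ : A.Weights} (hθ : θ.IsFullRank) :
    A.map P θ ∈ classC1 k (A.width 0) := by
  refine mem_classC1_iff.2 ⟨contDiff_map hP θ, fun x hx => ?_⟩
  obtain ⟨v, hv⟩ := tangent_surjective hP hA hθ x.ofLp (Fin.last A.L) fun _ => 1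
  have h := fderiv_map hk hP θ x (WithLp.toLp 2 v)
  simp [hx, hv] at h

/-! #### Augmented architectures -/

theorem layer_congr {P : A.Params} {θ θ' : A.Weights} (x : Fin (A.width 0) → ℝ)
    (l : Fin (A.L + 1)) (h : ∀ i : Fin A.L, i.castSucc < l → θ i = θ' i) :
    A.layer P θ x l = A.layer P θ' x l := by
  induction l using Fin.induction with
  | zero => rfl
  | succ l ih =>
    simp only [layer_succ, preact]
    rw [ih fun i hi => h i (hi.trans l.castSucc_lt_succ), h l l.castSucc_lt_succ]

/-- Only `W_l`, and not `W̃_l`, enters the argument of `σ_l`, so a perturbation of `W̃_l` leaves it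
unchanged. -/
theorem preact_congr {P : A.Params} {θ θ' : A.Weights} (x : Fin (A.width 0) → ℝ)
    (l : Fin A.L) (h : ∀ i < l, θ i = θ' i) (hl : (θ l).1 = (θ' l).1) :
    A.preact P θ x l = A.preact P θ' x l := by
  simp only [preact, hl,
    layer_congr x l.castSucc fun i hi => h i (Fin.castSucc_lt_castSucc_iff.1 hi)]

theorem tangent_congr {P : A.Params} {θ θ' : A.Weights} (x v : Fin (A.width 0) → ℝ)
    (l : Fin (A.L + 1)) (h : ∀ i : Fin A.L, i.castSucc < l → θ i = θ' i) :
    A.tangent P θ x v l = A.tangent P θ' x v l := by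
  induction l using Fin.induction with
  | zero => rw [tangent_zero, tangent_zero]
  | succ l ih =>
    have h1 := ih fun i hi => h i (hi.trans l.castSucc_lt_succ)
    have h2 := h l l.castSucc_lt_succ
    have h3 : A.preact P θ x l = A.preact P θ' x l :=
      preact_congr x l (fun i hi => h i ((Fin.castSucc_lt_castSucc_iff.2 hi).trans
        l.castSucc_lt_succ)) (by rw [h2])
    refine (tangent_succ P θ x v l).trans (Eq.trans ?_ (tangent_succ P θ' x v l).symm)
    rw [h1, h2, h3]

theorem Weights.add_smul_single_same (θ : A.Weights) (t : ℝ) (l : Fin A.L)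
    (q : (Fin (A.inner l) → Fin (A.width l.castSucc) → ℝ) ×
      (Fin (A.width l.succ) → Fin (A.inner l) → ℝ)) :
    (θ + t • (Pi.single l q : A.Weights)) l = θ l + t • q := by
  rw [Pi.add_apply, Pi.smul_apply, Pi.single_eq_same]

theorem Weights.add_smul_single_of_ne (θ : A.Weights) (t : ℝ) {l i : Fin A.L} (h : i ≠ l)
    (q : (Fin (A.inner l) → Fin (A.width l.castSucc) → ℝ) ×
      (Fin (A.width l.succ) → Fin (A.inner l) → ℝ)) :
    (θ + t • (Pi.single l q : A.Weights)) i = θ i := by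
  rw [Pi.add_apply, Pi.smul_apply, Pi.single_eq_of_ne h, smul_zero, add_zero]

/-- In an augmented architecture with full rank weights, the tangent vectors `h_l'(x) v` either do
not vanish, or the layer `h_l` comes after the widest one and their derivative in the weights is
surjective. -/
theorem tangent_ne_zero_or_vanishesTransversely {P : A.Params} {k : ℕ} (hk : 2 ≤ k)
    (hP : P.IsAdmissible k) {M : Fin (2 * A.L + 1)} (hmono : MonotoneOn A.allWidths (Iic M))
    (hanti : AntitoneOn A.allWidths (Ici M)) {θ : A.Weights} (hθ : θ.IsFullRank)
    (x : Fin (A.width 0) → ℝ) {v : Fin (A.width 0) → ℝ} (hv : v ≠ 0) (l : Fin (A.L + 1)) :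
    A.tangent P θ x v l ≠ 0 ∨
      (M.1 < 2 * l.1 ∧ VanishesTransversely (fun θ => A.tangent P θ x v l) θ) := by
  induction l using Fin.induction with
  | zero => exact Or.inl hv
  | succ l ih =>
    have hl := l.2
    have e0 := A.allWidths_even l.castSucc (by simp)
    have e1 := A.allWidths_odd l (by omega)
    have e2 := A.allWidths_even l.succ (by simp)
    -- In the sequence of all widths, `h_l` has position `2 * l` and the inner layer after it
    -- position `2 * l + 1`. From `M` on (`d1`, `d2`) full rank means surjective; before `M` (`u1`,
    -- `u2`) it means injective.
    have d1 : M.1 ≤ 2 * l.1 → A.inner l ≤ A.width l.castSucc := fun h => by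
      rw [← e0, ← e1]
      exact hanti (by simpa [Fin.le_def] using h) (by simp [Fin.le_def]; omega) (by simp)
    have u1 : 2 * l.1 < M.1 → A.width l.castSucc ≤ A.inner l := fun h => by
      rw [← e0, ← e1]
      exact hmono (by simp [Fin.le_def]; omega) (by simp [Fin.le_def]; omega) (by simp)
    have d2 : M.1 ≤ 2 * l.1 + 1 → A.width l.succ ≤ A.inner l := fun h => by
      rw [← e1, ← e2]
      exact hanti (by simpa [Fin.le_def] using h) (by simp [Fin.le_def]; omega)
        (by simp [Fin.le_def])
    have u2 : 2 * l.1 + 1 < M.1 → A.inner l ≤ A.width l.succ := fun h => by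
      rw [← e1, ← e2]
      exact hmono (by simp [Fin.le_def]; omega) (by simp [Fin.le_def]; omega)
        (by simp [Fin.le_def])
    have hq : (Matrix.of (θ l).1).mulVec (A.tangent P θ x v l.castSucc) ≠ 0 ∨
        (M.1 ≤ 2 * l.1 ∧ VanishesTransversely
          (fun θ => (Matrix.of (θ l).1).mulVec (A.tangent P θ x v l.castSucc)) θ) := by
      rcases ih with h | ⟨hM, h⟩
      · by_cases h0 : (Matrix.of (θ l).1).mulVec (A.tangent P θ x v l.castSucc) = 0
        -- A nonzero vector was killed by `W_l`, which is therefore not injective, so the widest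
        -- layer has already been reached.
        · have hM : M.1 ≤ 2 * l.1 := by
            by_contra hM
            exact h ((hθ l).1.mulVec_injective (u1 (by omega))
              (h0.trans (Matrix.mulVec_zero _).symm))
          -- The perturbation varies `W_l` alone; the incoming tangent vector depends only on
          -- earlier weights.
          refine Or.inr ⟨hM, vanishesTransversely_mulVec_of_ne_zero
            (p := fun θ => A.tangent P θ x v l.castSucc)
            (W := fun θ : A.Weights => Matrix.of (θ l).1) h h0 fun B =>
            ⟨Pi.single l (Matrix.of.symm B, 0), fun t => ⟨?_, ?_⟩⟩⟩
          · rw [Weights.add_smul_single_same]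
            rfl
          · exact tangent_congr x v _ fun i hi =>
              Weights.add_smul_single_of_ne θ t (Fin.castSucc_lt_castSucc_iff.1 hi).ne _
        · exact Or.inl h0
      · have hM' : M.1 ≤ 2 * l.1 := by simp at hM; omega
        exact Or.inr ⟨hM', h.mulVec (W := fun θ : A.Weights => Matrix.of (θ l).1)
          (D := fun θ => Matrix.of (θ l).1) (fun _ _ => rfl)
          ((hθ l).1.mulVec_surjective (d1 hM'))⟩
    have hr : (fun i => deriv (P.act l i) (A.preact P θ x l i) *
          (Matrix.of (θ l).1).mulVec (A.tangent P θ x v l.castSucc) i) ≠ 0 ∨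
        (M.1 ≤ 2 * l.1 ∧ VanishesTransversely
          (fun θ i => deriv (P.act l i) (A.preact P θ x l i) *
            (Matrix.of (θ l).1).mulVec (A.tangent P θ x v l.castSucc) i) θ) := by
      rcases hq with h | ⟨hM, h⟩
      · refine Or.inl fun h0 => h ?_
        ext i
        exact (mul_eq_zero.1 (congrFun h0 i)).resolve_left ((hP l i).2 _)
      · refine Or.inr ⟨hM, h.mul (a := fun θ i => deriv (P.act l i) (A.preact P θ x l i))
          (fun i => (hP l i).2 _) fun δ i => ?_⟩
        -- Two derivatives of the activation are needed: the factor `σ_l'`, evaluated at an argument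
        -- depending on the weights, has to be differentiable in them.
        have h1 : ContDiff ℝ 2 (P.act l i) := (hP l i).1.of_le (by exact_mod_cast hk)
        have h2 : Differentiable ℝ (deriv (P.act l i)) :=
          ((contDiff_succ_iff_deriv (n := 1)).1 h1).2.2.differentiable (by simp)
        have h3 : ContDiff ℝ k fun t : ℝ => A.preact P (θ + t • δ) x l i :=
          (contDiff_pi.1 (contDiff_preact hP l) i).comp
            (f := fun t : ℝ => (θ + t • δ, x)) (by fun_prop)
        exact (h2 _).comp _ (h3.differentiable (by exact_mod_cast (by omega : k ≠ 0)) 0)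
    simp only [tangent_succ]
    rcases hr with h | ⟨hM, h⟩
    · by_cases h0 : (Matrix.of (θ l).2).mulVec (fun i => deriv (P.act l i) (A.preact P θ x l i) *
          (Matrix.of (θ l).1).mulVec (A.tangent P θ x v l.castSucc) i) = 0
      -- The same dichotomy for `W̃_l`, whose perturbation affects neither the preactivation nor the
      -- incoming tangent vector.
      · have hM : M.1 ≤ 2 * l.1 + 1 := by
          by_contra hM
          exact h ((hθ l).2.mulVec_injective (u2 (by omega))
            (h0.trans (Matrix.mulVec_zero _).symm))
        refine Or.inr ⟨by simp; omega, vanishesTransversely_mulVec_of_ne_zero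
          (p := fun θ i => deriv (P.act l i) (A.preact P θ x l i) *
            (Matrix.of (θ l).1).mulVec (A.tangent P θ x v l.castSucc) i)
          (W := fun θ : A.Weights => Matrix.of (θ l).2) h h0 fun B =>
          ⟨Pi.single l (0, Matrix.of.symm B), fun t => ⟨?_, ?_⟩⟩⟩
        · rw [Weights.add_smul_single_same]
          rfl
        · have hi' : ∀ i < l, (θ + t • (Pi.single l (0, Matrix.of.symm B) : A.Weights)) i = θ i :=
            fun i hi => Weights.add_smul_single_of_ne θ t hi.ne _
          have hl' : ((θ + t • (Pi.single l (0, Matrix.of.symm B) : A.Weights)) l).1 = (θ l).1 := by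
            rw [Weights.add_smul_single_same, Prod.fst_add, Prod.smul_fst, smul_zero, add_zero]
          beta_reduce
          rw [preact_congr x l hi' hl', hl', tangent_congr x v l.castSucc
            fun i hi => hi' i (Fin.castSucc_lt_castSucc_iff.1 hi)]
      · exact Or.inl h0
    · exact Or.inr ⟨by simp; omega, h.mulVec (W := fun θ : A.Weights => Matrix.of (θ l).2)
        (D := fun θ => Matrix.of (θ l).2) (fun _ _ => rfl)
        ((hθ l).2.mulVec_surjective (d2 (by omega)))⟩

theorem isAddHaarMeasure_volume_matrix_prod (a b c d : ℕ) :
    (volume : Measure ((Fin a → Fin b → ℝ) × (Fin c → Fin d → ℝ))).IsAddHaarMeasure := by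
  have h (a b : ℕ) :
    (volume : Measure (Fin a → Fin b → ℝ)).IsAddHaarMeasure :=
    Measure.pi.isAddHaarMeasure (fun _ => volume)
  exact Measure.prod.instIsAddHaarMeasure volume volume
theorem Weights.isAddHaarMeasure_volume (A : MLPArch) :
    (volume : Measure A.Weights).IsAddHaarMeasure := by
  have h (l : Fin A.L) :=
    isAddHaarMeasure_volume_matrix_prod (A.inner l) (A.width l.castSucc) (A.width l.succ)
      (A.inner l)
  exact Measure.pi.isAddHaarMeasure (fun _ => volume)

/-- At a critical point the last tangent vector is the number `dΦ(x) v = 0`. The alternative that it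
is nonzero is thus excluded, and the other one is the hypothesis of
`ae_nondegenerate_of_transverse`. -/
theorem ae_map_mem_classC1_union_classC2 {P : A.Params} {k : ℕ} (hk : 2 ≤ k)
    (hP : P.IsAdmissible k) (hA : A.IsAugmented) :
    ∀ᵐ θ : A.Weights, A.map P θ ∈ classC1 k (A.width 0) ∪ classC2 k (A.width 0) := by
  obtain ⟨M, -, hmono, hanti⟩ := hA
  have := Weights.isAddHaarMeasure_volume A
  filter_upwards [ae_nondegenerate_of_transverse volume (A.map P), Weights.ae_isFullRank A]
    with θ hθ hfull
  refine mem_classC1_union_classC2 hk (contDiff_map hP θ) fun x hx =>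
    hθ x ((contDiff_map_uncurry hP).of_le (by exact_mod_cast hk)).contDiffAt hx fun v hv => ?_
  have hv' : v.ofLp ≠ 0 := fun h => hv (by ext i; exact congrFun h i)
  have h0 := fderiv_map (by omega) hP θ x v
  rcases tangent_ne_zero_or_vanishesTransversely hk hP hmono hanti hfull x.ofLp hv' (Fin.last A.L)
    with h | ⟨-, -, h⟩
  · refine absurd (funext fun i => ?_) h
    have hi : i = ⟨0, A.width_pos _⟩ := by
      have := i.2
      simp only [A.width_last] at this
      ext
      simp
      omega
    rw [hi, ← h0, hx]
    rfl
  · obtain ⟨δ, hδ⟩ := h fun _ => 1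
    refine ⟨δ, 1, one_ne_zero, ?_⟩
    simp only [fderiv_map (by omega : 1 ≤ k) hP]
    exact hasDerivAt_pi.1 hδ _

end MLPArch

/-! ### Superposition operators on spaces of continuous functions -/

section Superposition

open Topology Filter

variable {K : Type} [TopologicalSpace K] [CompactSpace K] [LocallyCompactSpace K]
  {E F : Type} [NormedAddCommGroup E] [NormedSpace ℝ E] [NormedAddCommGroup F] [NormedSpace ℝ F]

/-- Pointwise application of a continuous family of continuous linear maps. -/
noncomputable def pointwiseApply (K E F : Type) [TopologicalSpace K] [CompactSpace K]
    [NormedAddCommGroup E] [NormedSpace ℝ E] [NormedAddCommGroup F] [NormedSpace ℝ F] :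
    C(K, E →L[ℝ] F) →L[ℝ] C(K, E) →L[ℝ] C(K, F) :=
  LinearMap.mkContinuous₂
    (LinearMap.mk₂ ℝ (fun (A : C(K, E →L[ℝ] F)) (h : C(K, E)) =>
        (⟨fun s => A s (h s), A.continuous.clm_apply h.continuous⟩ : C(K, F)))
      (fun _ _ _ => rfl) (fun _ _ _ => rfl)
      (fun A h₁ h₂ => by ext s; exact map_add (A s) _ _)
      (fun c A h => by ext s; exact map_smul (A s) c _))
    1 fun A h => by
      refine (ContinuousMap.norm_le _ (by rw [one_mul]; positivity)).2 fun s => ?_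
      rw [one_mul]
      exact ((A s).le_opNorm _).trans (mul_le_mul (A.norm_coe_le_norm s) (h.norm_coe_le_norm s)
        (norm_nonneg _) (norm_nonneg A))

omit [LocallyCompactSpace K] in
theorem pointwiseApply_apply (A : C(K, E →L[ℝ] F)) (h : C(K, E)) (s : K) :
    pointwiseApply K E F A h s = A s (h s) := rfl

/-- The superposition operator `h ↦ (s ↦ G (s, h s))`. -/
def superposition (G : C(K × E, F)) (h : C(K, E)) : C(K, F) :=
  G.comp ((ContinuousMap.id K).prodMk h)

omit [CompactSpace K] [LocallyCompactSpace K] [NormedSpace ℝ E] [NormedSpace ℝ F] in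
theorem superposition_apply (G : C(K × E, F)) (h : C(K, E)) (s : K) :
    superposition G h s = G (s, h s) := rfl

omit [CompactSpace K] [NormedSpace ℝ E] [NormedSpace ℝ F] in
theorem continuous_superposition (G : C(K × E, F)) : Continuous (superposition G) :=
  ContinuousMap.continuous_of_continuous_uncurry _ <|
    G.continuous.comp (continuous_snd.prodMk continuous_eval)

/-- The mean value inequality is applied at each `s`. The estimate is uniform in `s` because the
superposition operator of `G'` is continuous in the supremum norm. -/
theorem hasFDerivAt_superposition {G : C(K × E, F)} {G' : C(K × E, E →L[ℝ] F)}
    (hG : ∀ s y, HasFDerivAt (fun y => G (s, y)) (G' (s, y)) y) (h : C(K, E)) :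
    HasFDerivAt (superposition G) (pointwiseApply K E F (superposition G' h)) h := by
  rw [hasFDerivAt_iff_isLittleO_nhds_zero, Asymptotics.isLittleO_iff]
  intro ε hε
  have hc := Metric.continuousAt_iff.1 ((continuous_superposition G').continuousAt (x := h)) ε hε
  obtain ⟨δ, hδ, hc⟩ := hc
  filter_upwards [Metric.ball_mem_nhds (0 : C(K, E)) hδ] with η hη
  refine (ContinuousMap.norm_le _ (by positivity)).2 fun s => ?_
  have hη' : ‖η‖ < δ := by simpa using hη
  have hb : ∀ y ∈ Metric.ball (h s) δ, ‖G' (s, y) - G' (s, h s)‖ ≤ ε := by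
    intro y hy
    -- The point `y` is reached by translating `h` by a constant, which turns continuity in function
    -- space into a bound at `(s, y)`.
    have h1 : dist (h + ContinuousMap.const K (y - h s)) h < δ := by
      rw [dist_eq_norm, add_sub_cancel_left]
      refine lt_of_le_of_lt ((ContinuousMap.norm_le _ (norm_nonneg (y - h s))).2 fun _ => le_rfl) ?_
      rwa [← dist_eq_norm]
    have h2 := (ContinuousMap.dist_apply_le_dist s).trans (hc h1).le
    rw [dist_eq_norm] at h2
    simpa [superposition_apply] using h2
  have hmem : h s + η s ∈ Metric.ball (h s) δ := by
    simpa using (η.norm_coe_le_norm s).trans_lt hη'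
  have h3 := (convex_ball (h s) δ).norm_image_sub_le_of_norm_hasFDerivWithin_le'
    (fun y _ => (hG s y).hasFDerivWithinAt) hb (Metric.mem_ball_self hδ) hmem
  rw [add_sub_cancel_left] at h3
  exact h3.trans (mul_le_mul_of_nonneg_left (η.norm_coe_le_norm s) hε.le)

/-- Induction on `k`: the derivative is the superposition operator of `G'` followed by the bounded
linear map `pointwiseApply`. The target `F` varies in the induction since `G'` takes values in `E
→L[ℝ] F`. -/
theorem contDiff_superposition (k : ℕ) : ∀ {F : Type} [NormedAddCommGroup F] [NormedSpace ℝ F]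
    (G : C(K × E, F)), (∀ s, ContDiff ℝ k fun y => G (s, y)) →
    (∀ j ≤ k, Continuous fun p : K × E => iteratedFDeriv ℝ j (fun y => G (p.1, y)) p.2) →
    ContDiff ℝ k (superposition G) := by
  induction k with
  | zero => exact fun G _ _ => contDiff_zero.2 (continuous_superposition G)
  | succ k ih =>
    intro F _ _ G hG hcont
    have hsucc : ∀ j (p : K × E), iteratedFDeriv ℝ j (fderiv ℝ fun y => G (p.1, y)) p.2 =
        (continuousMultilinearCurryRightEquiv' ℝ j E F)
          (iteratedFDeriv ℝ (j + 1) (fun y => G (p.1, y)) p.2) := by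
      intro j p
      rw [iteratedFDeriv_succ_eq_comp_right]
      simp
    have hc0 : Continuous fun p : K × E => fderiv ℝ (fun y => G (p.1, y)) p.2 := by
      have h1 : Continuous fun p : K × E =>
          iteratedFDeriv ℝ 0 (fderiv ℝ fun y => G (p.1, y)) p.2 := by
        simp only [hsucc]
        exact (LinearIsometryEquiv.continuous _).comp (hcont 1 (by omega))
      have h2 := (continuousMultilinearCurryFin0 ℝ E (E →L[ℝ] F)).continuous.comp h1
      exact h2
    let G' : C(K × E, E →L[ℝ] F) := ⟨_, hc0⟩
    have hd : ∀ s y, HasFDerivAt (fun y => G (s, y)) (G' (s, y)) y := fun s y =>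
      ((hG s).differentiable (by simp) y).hasFDerivAt
    have hG' : ContDiff ℝ k (superposition G') := by
      refine ih G' (fun s => ?_) fun j hj => ?_
      · exact (contDiff_succ_iff_fderiv (n := k).1 (by exact_mod_cast hG s)).2.2
      · have : (fun p : K × E => iteratedFDeriv ℝ j (fun y => G' (p.1, y)) p.2) =
            fun p => (continuousMultilinearCurryRightEquiv' ℝ j E F)
              (iteratedFDeriv ℝ (j + 1) (fun y => G (p.1, y)) p.2) := funext fun p => hsucc j p
        rw [this]
        exact (LinearIsometryEquiv.continuous _).comp (hcont (j + 1) (by omega))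
    have := contDiff_succ_iff_hasFDerivAt (n := k).2
      ⟨fun h => pointwiseApply K E F (superposition G' h),
        hG'.continuousLinearMap_comp (pointwiseApply K E F), hasFDerivAt_superposition hd⟩
    exact_mod_cast this

end Superposition

/-! ### Volterra operators -/

section Volterra

variable {E : Type} [NormedAddCommGroup E] [NormedSpace ℝ E] [CompleteSpace E] {T : ℝ}

/-- The primitive `t ↦ ∫₀ᵗ g` of a continuous function on `[0, T]`. -/
noncomputable def primitive (E : Type) [NormedAddCommGroup E] [NormedSpace ℝ E]
    {T : ℝ} (hT : 0 ≤ T) : C(Icc 0 T, E) →L[ℝ] C(Icc 0 T, E) :=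
  LinearMap.mkContinuous
    { toFun := fun g => ⟨fun t => ∫ s in (0 : ℝ)..t, g (projIcc 0 T hT s),
        (intervalIntegral.continuous_primitive (fun a b =>
          (g.continuous.comp continuous_projIcc).intervalIntegrable a b) 0).comp
            continuous_subtype_val⟩
      map_add' := fun g₁ g₂ => by
        ext t
        exact intervalIntegral.integral_add
          ((g₁.continuous.comp continuous_projIcc).intervalIntegrable _ _)
          ((g₂.continuous.comp continuous_projIcc).intervalIntegrable _ _)
      map_smul' := fun c g => by
        ext t
        exact intervalIntegral.integral_smul c _ }
    T fun g => by
      refine (ContinuousMap.norm_le _ (by positivity)).2 fun t => ?_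
      refine (intervalIntegral.norm_integral_le_of_norm_le_const
        fun s _ => g.norm_coe_le_norm (projIcc 0 T hT s)).trans ?_
      rw [sub_zero, abs_of_nonneg t.2.1, mul_comm]
      exact mul_le_mul_of_nonneg_right t.2.2 (norm_nonneg _)

omit [CompleteSpace E] in
theorem primitive_apply (hT : 0 ≤ T) (g : C(Icc 0 T, E)) (t : Icc 0 T) :
    primitive E hT g t = ∫ s in (0 : ℝ)..t, g (projIcc 0 T hT s) := rfl

theorem hasDerivWithinAt_primitive (hT : 0 ≤ T) (g : C(Icc 0 T, E)) {t : ℝ} (ht : t ∈ Icc 0 T) :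
    HasDerivWithinAt (fun t => primitive E hT g (projIcc 0 T hT t)) (g ⟨t, ht⟩) (Icc 0 T) t := by
  have hc : Continuous fun s => g (projIcc 0 T hT s) := g.continuous.comp continuous_projIcc
  have h1 : HasDerivAt (fun t => ∫ s in (0 : ℝ)..t, g (projIcc 0 T hT s))
      (g (projIcc 0 T hT t)) t := hc.integral_hasStrictDerivAt 0 t |>.hasDerivAt
  rw [projIcc_of_mem hT ht] at h1
  refine h1.hasDerivWithinAt.congr (fun s hs => ?_) ?_
  · rw [projIcc_of_mem hT hs, primitive_apply]
  · rw [projIcc_of_mem hT ht, primitive_apply]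

omit [CompleteSpace E] in
-- Each iteration integrates the previous bound, and integrating `s ^ n / n!` gives `t ^ (n + 1) /
-- (n + 1)!`. The bound must be kept pointwise in `t` for this gain.
theorem norm_volterra_pow_le (hT : 0 ≤ T) (A : C(Icc 0 T, E →L[ℝ] E)) (n : ℕ)
    (g : C(Icc 0 T, E)) (t : Icc 0 T) :
    ‖(((primitive E hT).comp (pointwiseApply (Icc 0 T) E E A)) ^ n) g t‖ ≤
      ‖A‖ ^ n * (t : ℝ) ^ n / n.factorial * ‖g‖ := by
  induction n generalizing t with
  | zero => simpa using g.norm_coe_le_norm t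
  | succ n ih =>
    rw [pow_succ', mul_apply_eq_comp, ContinuousLinearMap.comp_apply, primitive_apply]
    set u := (((primitive E hT).comp (pointwiseApply (Icc 0 T) E E A)) ^ n) g
    have hbound : ∀ s ∈ Ioc (0 : ℝ) t, ‖pointwiseApply (Icc 0 T) E E A u (projIcc 0 T hT s)‖ ≤
        (‖A‖ ^ (n + 1) / n.factorial * ‖g‖) * s ^ n := by
      intro s hs
      have hsT : s ∈ Icc 0 T := ⟨hs.1.le, hs.2.trans t.2.2⟩
      rw [projIcc_of_mem hT hsT, pointwiseApply_apply]
      refine ((A _).le_opNorm _).trans ?_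
      refine (mul_le_mul (A.norm_coe_le_norm _) (ih ⟨s, hsT⟩) (norm_nonneg _)
        (norm_nonneg _)).trans (le_of_eq ?_)
      ring
    refine (intervalIntegral.norm_integral_le_of_norm_le t.2.1
      (Filter.Eventually.of_forall hbound)
      ((continuous_const.mul (continuous_pow n)).intervalIntegrable _ _)).trans (le_of_eq ?_)
    rw [intervalIntegral.integral_const_mul, integral_pow, Nat.factorial_succ]
    have := n.factorial_ne_zero
    push_cast
    field_simp
    ring

/-- The identity minus a Volterra operator is invertible. -/
theorem isUnit_one_sub_volterra (hT : 0 ≤ T) (A : C(Icc 0 T, E →L[ℝ] E)) :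
    IsUnit (1 - (primitive E hT).comp (pointwiseApply (Icc 0 T) E E A)) := by
  set V := (primitive E hT).comp (pointwiseApply (Icc 0 T) E E A)
  obtain ⟨n, hn⟩ := ((FloorSemiring.tendsto_pow_div_factorial_atTop (‖A‖ * T)).eventually
    (gt_mem_nhds one_pos)).exists
  have hV : ‖V ^ n‖ < 1 := by
    refine lt_of_le_of_lt (ContinuousLinearMap.opNorm_le_bound _ (by positivity) fun g => ?_) hn
    refine (ContinuousMap.norm_le _ (by positivity)).2 fun t => ?_
    refine (norm_volterra_pow_le hT A n g t).trans ?_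
    rw [mul_pow]
    have := t.2.1
    have := t.2.2
    gcongr
  -- The Neumann series inverts `1 - V ^ n`, which factors as `1 - V` times a geometric sum
  -- commuting with it; hence `1 - V` is a unit.
  have h1 := isUnit_one_sub_of_norm_lt_one (x := V ^ n) hV
  rw [← mul_neg_geom_sum] at h1
  refine (Commute.isUnit_mul_iff ?_).1 h1 |>.1
  exact (Commute.one_left _).sub_left (Commute.sum_right _ _ _ fun i _ => Commute.self_pow V i)

end Volterra

/-! ### Flows of time-dependent vector fields -/

section Flow

open Topology Filter

variable {E : Type} [NormedAddCommGroup E] [NormedSpace ℝ E] {T : ℝ}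

/-- The curve `q.2` solves the integral equation of `h' = G(t, h)`, `h 0 = q.1` if and only if
`flowDefect` vanishes. -/
noncomputable def flowDefect (hT : 0 ≤ T) (G : C(Icc 0 T × E, E)) (q : E × C(Icc 0 T, E)) :
    C(Icc 0 T, E) :=
  q.2 - ContinuousLinearMap.const ℝ (Icc 0 T) q.1 - primitive E hT (superposition G q.2)

theorem contDiff_flowDefect (hT : 0 ≤ T) {k : ℕ} {G : C(Icc 0 T × E, E)}
    (hG : ContDiff ℝ k (superposition G)) : ContDiff ℝ k (flowDefect hT G) :=
  (contDiff_snd.sub (contDiff_fst.continuousLinearMap_comp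
    (ContinuousLinearMap.const ℝ (Icc 0 T)))).sub
      ((hG.comp contDiff_snd).continuousLinearMap_comp (primitive E hT))

theorem flowDefect_eq_zero_iff (hT : 0 ≤ T) {G : C(Icc 0 T × E, E)} {p : E} {H : C(Icc 0 T, E)} :
    flowDefect hT G (p, H) = 0 ↔ ∀ t, H t = p + primitive E hT (superposition G H) t := by
  rw [flowDefect, sub_sub, sub_eq_zero, ContinuousMap.ext_iff]
  rfl

theorem eq_initial_add_primitive (hT : 0 ≤ T) [CompleteSpace E] {g : C(Icc 0 T, E)} {h : ℝ → E}
    (hh : ∀ t (ht : t ∈ Icc 0 T), HasDerivWithinAt h (g ⟨t, ht⟩) (Icc 0 T) t) (t : Icc 0 T) :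
    h t = h 0 + primitive E hT g t := by
  have hc : ContinuousOn h (Icc 0 T) := fun t ht => (hh t ht).continuousWithinAt
  have hi := intervalIntegral.integral_eq_sub_of_hasDerivAt_of_le t.2.1
    (f' := fun s => g (projIcc 0 T hT s)) (hc.mono (Icc_subset_Icc_right t.2.2)) (fun s hs => ?_)
    ((g.continuous.comp continuous_projIcc).intervalIntegrable _ _)
  · rw [primitive_apply, hi]
    abel
  · have hs' : s ∈ Ioo 0 T := ⟨hs.1, hs.2.trans_le t.2.2⟩
    rw [projIcc_of_mem hT (Ioo_subset_Icc_self hs')]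
    exact (hh s (Ioo_subset_Icc_self hs')).hasDerivAt (Icc_mem_nhds hs'.1 hs'.2)

theorem hasDerivWithinAt_of_eq_add_primitive [CompleteSpace E] (hT : 0 ≤ T) {p : E}
    {g H : C(Icc 0 T, E)} (hH : ∀ t, H t = p + primitive E hT g t) {t : ℝ} (ht : t ∈ Icc 0 T) :
    HasDerivWithinAt (fun t => H (projIcc 0 T hT t)) (g ⟨t, ht⟩) (Icc 0 T) t := by
  simp only [hH]
  exact (hasDerivWithinAt_primitive hT g ht).const_add p

/-- Both curves stay in a common closed ball. On the compact product of `[0, T]` with it `G'` is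
bounded, so `G` is uniformly Lipschitz in space and ODE uniqueness applies. -/
theorem flowDefect_unique [ProperSpace E] (hT : 0 ≤ T) {G : C(Icc 0 T × E, E)}
    {G' : C(Icc 0 T × E, E →L[ℝ] E)} (hG : ∀ s y, HasFDerivAt (fun y => G (s, y)) (G' (s, y)) y)
    {p : E} {H₁ H₂ : C(Icc 0 T, E)} (h₁ : flowDefect hT G (p, H₁) = 0)
    (h₂ : flowDefect hT G (p, H₂) = 0) : H₁ = H₂ := by
  rw [flowDefect_eq_zero_iff] at h₁ h₂
  have d₁ := fun {t} ht => hasDerivWithinAt_of_eq_add_primitive hT h₁ (t := t) ht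
  have d₂ := fun {t} ht => hasDerivWithinAt_of_eq_add_primitive hT h₂ (t := t) ht
  set R := max ‖H₁‖ ‖H₂‖
  have hcomp : IsCompact ((univ : Set (Icc 0 T)) ×ˢ Metric.closedBall (0 : E) R) :=
    isCompact_univ.prod (isCompact_closedBall _ _)
  obtain ⟨C, hC⟩ := hcomp.exists_bound_of_continuousOn G'.continuous.continuousOn
  have hlip : ∀ t, LipschitzOnWith C.toNNReal (fun y => G (projIcc 0 T hT t, y))
      (Metric.closedBall 0 R) := fun t => by
    refine (convex_closedBall _ _).lipschitzOnWith_of_nnnorm_hasFDerivWithin_le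
      (fun y _ => (hG _ y).hasFDerivWithinAt) fun y hy => ?_
    rw [← NNReal.coe_le_coe, coe_nnnorm]
    exact (hC _ ⟨mem_univ _, hy⟩).trans (Real.le_coe_toNNReal C)
  have hv : ∀ (H : C(Icc 0 T, E)) t (ht : t ∈ Icc 0 T),
      superposition G H ⟨t, ht⟩ = G (projIcc 0 T hT t, H (projIcc 0 T hT t)) := fun H t ht => by
    rw [superposition_apply, projIcc_of_mem hT ht]
  have key := ODE_solution_unique_of_mem_Icc_right (a := 0) (b := T)
    (v := fun t y => G (projIcc 0 T hT t, y)) (s := fun _ => Metric.closedBall 0 R)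
    (f := fun t => H₁ (projIcc 0 T hT t)) (g := fun t => H₂ (projIcc 0 T hT t))
    (fun t _ => hlip t) (H₁.continuous.comp continuous_projIcc).continuousOn
    (fun t ht => by
      have := (d₁ (Ico_subset_Icc_self ht)).mono_of_mem_nhdsWithin (Icc_mem_nhdsGE_of_mem ht)
      rwa [hv] at this)
    (fun t _ => mem_closedBall_zero_iff.2 ((H₁.norm_coe_le_norm _).trans (le_max_left _ _)))
    (H₂.continuous.comp continuous_projIcc).continuousOn
    (fun t ht => by
      have := (d₂ (Ico_subset_Icc_self ht)).mono_of_mem_nhdsWithin (Icc_mem_nhdsGE_of_mem ht)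
      rwa [hv] at this)
    (fun t _ => mem_closedBall_zero_iff.2 ((H₂.norm_coe_le_norm _).trans (le_max_right _ _)))
    (by
      rw [h₁, h₂, projIcc_left]
      simp [primitive_apply])
  ext t
  have := key t.2
  simpa [projIcc_val] using this

/-- A solution of a linear differential equation that vanishes at the final time vanishes. -/
theorem eq_zero_of_linear_ode [CompleteSpace E] (hT : 0 ≤ T) {A : C(Icc 0 T, E →L[ℝ] E)} {p : E}
    {η : C(Icc 0 T, E)}
    (hη : ∀ t, η t = p + primitive E hT (pointwiseApply (Icc 0 T) E E A η) t)
    (hfin : η ⟨T, right_mem_Icc.2 hT⟩ = 0) : p = 0 := by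
  have key := ODE_solution_unique_of_mem_Icc_left (a := 0) (b := T) (K := ‖A‖₊)
    (v := fun t y => A (projIcc 0 T hT t) y) (s := fun _ => univ)
    (f := fun t => η (projIcc 0 T hT t)) (g := fun _ => 0)
    (fun t _ => (((A (projIcc 0 T hT t)).lipschitz.weaken
      (A.norm_coe_le_norm _))).lipschitzOnWith)
    (η.continuous.comp continuous_projIcc).continuousOn
    (fun t ht => by
      have := (hasDerivWithinAt_of_eq_add_primitive hT hη
        (Ioc_subset_Icc_self ht)).mono_of_mem_nhdsWithin (Icc_mem_nhdsLE_of_mem ht)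
      rwa [pointwiseApply_apply, ← projIcc_of_mem hT (Ioc_subset_Icc_self ht)] at this)
    (fun _ _ => mem_univ _) continuousOn_const
    (fun t _ => by
      rw [map_zero]
      exact hasDerivWithinAt_const _ _ _)
    (fun _ _ => mem_univ _) (by rw [projIcc_right]; exact hfin)
  have h0 := key (left_mem_Icc.2 hT)
  have h1 := hη ⟨0, left_mem_Icc.2 hT⟩
  simp only [projIcc_left] at h0
  rw [h0] at h1
  simpa [primitive_apply] using h1.symm

/-- The flow of a time-dependent vector field that is `C^k` in space. -/
theorem exists_contDiffAt_flow [ProperSpace E] (hT : 0 ≤ T) {k : ℕ} (hk : 1 ≤ k)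
    {G : C(Icc 0 T × E, E)} {G' : C(Icc 0 T × E, E →L[ℝ] E)}
    (hG : ∀ s y, HasFDerivAt (fun y => G (s, y)) (G' (s, y)) y)
    (hGk : ContDiff ℝ k (superposition G)) :
    ∃ (U : Set E) (φ : E → E),
      (∀ p ∈ U, ContDiffAt ℝ k φ p ∧ Function.Injective (fderiv ℝ φ p)) ∧
      ∀ p H, flowDefect hT G (p, H) = 0 → p ∈ U ∧ H ⟨T, right_mem_Icc.2 hT⟩ = φ p := by
  classical
  -- The initial values whose solution exists on all of `[0, T]`; the value of `φ` outside `U` is a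
  -- dummy.
  let U : Set E := {p | ∃ H, flowDefect hT G (p, H) = 0}
  let ev : C(Icc 0 T, E) →L[ℝ] E := ContinuousMap.evalCLM ℝ ⟨T, right_mem_Icc.2 hT⟩
  let φ : E → E := fun p => if hp : p ∈ U then ev hp.choose else 0
  have hφ : ∀ p H, flowDefect hT G (p, H) = 0 → p ∈ U ∧ ev H = φ p := fun p H hH => by
    have hp : p ∈ U := ⟨H, hH⟩
    refine ⟨hp, ?_⟩
    simp only [φ, dif_pos hp]
    rw [flowDefect_unique hT hG hH hp.choose_spec]
  refine ⟨U, φ, ?_, hφ⟩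
  rintro p ⟨H, hH⟩
  have hk0 : (k : WithTop ℕ∞) ≠ 0 := by exact_mod_cast (by omega : k ≠ 0)
  have hc : ContDiffAt ℝ k (flowDefect hT G) (p, H) := (contDiff_flowDefect hT hGk).contDiffAt
  set A := superposition G' H
  have hD : HasFDerivAt (flowDefect hT G)
      ((ContinuousLinearMap.snd ℝ E C(Icc 0 T, E) -
        (ContinuousLinearMap.const ℝ (Icc 0 T)).comp (ContinuousLinearMap.fst ℝ E C(Icc 0 T, E))) -
        (primitive E hT).comp ((pointwiseApply (Icc 0 T) E E A).comp
          (ContinuousLinearMap.snd ℝ E C(Icc 0 T, E)))) (p, H) :=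
    (hasFDerivAt_snd.sub
      ((ContinuousLinearMap.const ℝ (Icc 0 T)).hasFDerivAt.comp (p, H) hasFDerivAt_fst)).sub
      ((primitive E hT).hasFDerivAt.comp (p, H)
        (HasFDerivAt.comp (p, H) (f := Prod.snd) (hasFDerivAt_superposition hG H)
          hasFDerivAt_snd))
  -- The partial derivative in the curve is the identity minus a Volterra operator.
  have hinv : (fderiv ℝ (flowDefect hT G) (p, H) ∘L .inr ℝ E C(Icc 0 T, E)).IsInvertible := by
    rw [hD.fderiv]
    obtain ⟨u, hu⟩ := isUnit_one_sub_volterra hT A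
    refine ⟨ContinuousLinearEquiv.unitsEquiv ℝ _ u, ?_⟩
    ext1 η
    have := DFunLike.congr_fun hu η
    rw [ContinuousLinearEquiv.coe_coe, ContinuousLinearEquiv.unitsEquiv_apply, this]
    simp
  set ψ := hc.implicitFunction hk0 hinv
  have hψ : ContDiffAt ℝ k ψ p := hc.contDiffAt_implicitFunction hk0 hinv
  have hψH : ψ p = H := hc.implicitFunction_apply_self hk0 hinv
  have hψ0 : ∀ᶠ q in 𝓝 p, flowDefect hT G (q, ψ q) = 0 := by
    filter_upwards [hc.eventually_apply_implicitFunction hk0 hinv] with q hq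
    exact hq.trans hH
  -- Near `p` the implicit function provides solutions on the whole interval, and by uniqueness
  -- their endpoints are the values of `φ`.
  have hφψ : φ =ᶠ[𝓝 p] fun q => ev (ψ q) := by
    filter_upwards [hψ0] with q hq
    exact (hφ q _ hq).2.symm
  refine ⟨(hψ.continuousLinearMap_comp ev).congr_of_eventuallyEq hφψ, ?_⟩
  have hψd := (hψ.differentiableAt hk0).hasFDerivAt
  have hev : HasFDerivAt (fun q => ev (ψ q)) (ev.comp (fderiv ℝ ψ p)) p :=
    ev.hasFDerivAt.comp p hψd
  rw [hφψ.fderiv_eq, hev.fderiv]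
  refine (injective_iff_map_eq_zero _).2 fun v hv => ?_
  have hD' : HasFDerivAt (flowDefect hT G) _ (p, ψ p) := hψH.symm ▸ hD
  have h1 := HasFDerivAt.comp p (f := fun q => (q, ψ q)) hD' ((hasFDerivAt_id p).prodMk hψd)
  have h2 := h1.unique ((hasFDerivAt_const (0 : C(Icc 0 T, E)) p).congr_of_eventuallyEq hψ0)
  have h3 := DFunLike.congr_fun h2 v
  -- Differentiating `flowDefect (q, ψ q) = 0` gives the variational equation for `η`, with initial
  -- value `v`. If its final value is zero, then `v = 0`.
  refine eq_zero_of_linear_ode hT (A := A) (η := fderiv ℝ ψ p v) (fun t => ?_) hv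
  have h4 := DFunLike.congr_fun h3 t
  simp only [ContinuousLinearMap.comp_apply, sub_apply,
    ContinuousLinearMap.prod_apply, ContinuousLinearMap.coe_snd', ContinuousLinearMap.coe_fst',
    ContinuousLinearMap.id_apply, zero_apply, ContinuousMap.sub_apply,
    ContinuousMap.zero_apply] at h4
  rw [sub_sub, sub_eq_zero] at h4
  exact h4

/-- The flow of a vector field of class `C^{0,k}`. -/
theorem IsC0kVectorField.exists_flow {m k : ℕ} {f : ℝ → (Fin m → ℝ) → (Fin m → ℝ)} (hk : 1 ≤ k)
    (hT : 0 ≤ T) (hf : IsC0kVectorField k T f) :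
    ∃ (U : Set (Fin m → ℝ)) (φ : (Fin m → ℝ) → (Fin m → ℝ)),
      (∀ p ∈ U, ContDiffAt ℝ k φ p ∧ Function.Injective (fderiv ℝ φ p)) ∧
      ∀ h : ℝ → (Fin m → ℝ), (∀ t ∈ Icc 0 T, HasDerivWithinAt h (f t (h t)) (Icc 0 T) t) →
        h 0 ∈ U ∧ h T = φ (h 0) := by
  have hcont : ∀ j ≤ k, Continuous fun p : Icc 0 T × (Fin m → ℝ) =>
      iteratedFDeriv ℝ j (f p.1) p.2 := fun j hj =>
    (hf.2 j hj).comp_continuous (f := fun p : Icc 0 T × (Fin m → ℝ) => ((p.1 : ℝ), p.2))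
      (by fun_prop) fun p => ⟨p.1.2, mem_univ _⟩
  have hc0 : Continuous fun p : Icc 0 T × (Fin m → ℝ) => f p.1 p.2 :=
    (continuousMultilinearCurryFin0 ℝ (Fin m → ℝ) (Fin m → ℝ)).continuous.comp
      (hcont 0 (Nat.zero_le k))
  have hc1 : Continuous fun p : Icc 0 T × (Fin m → ℝ) => fderiv ℝ (f p.1) p.2 := by
    have := (continuousMultilinearCurryFin1 ℝ (Fin m → ℝ) (Fin m → ℝ)).continuous.comp
      (hcont 1 hk)
    refine this.congr fun p => ?_
    ext1 v
    simp
  let G : C(Icc 0 T × (Fin m → ℝ), Fin m → ℝ) := ⟨_, hc0⟩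
  let G' : C(Icc 0 T × (Fin m → ℝ), (Fin m → ℝ) →L[ℝ] (Fin m → ℝ)) := ⟨_, hc1⟩
  have hk0 : (k : WithTop ℕ∞) ≠ 0 := by exact_mod_cast (by omega : k ≠ 0)
  obtain ⟨U, φ, hU, hφ⟩ := exists_contDiffAt_flow hT hk (G := G) (G' := G')
    (fun s y => ((hf.1 s s.2).differentiable hk0 y).hasFDerivAt)
    (contDiff_superposition k G (fun s => hf.1 s s.2) hcont)
  refine ⟨U, φ, hU, fun h hh => ?_⟩
  have hc : ContinuousOn h (Icc 0 T) := fun t ht => (hh t ht).continuousWithinAt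
  let H : C(Icc 0 T, Fin m → ℝ) := ⟨fun t => h t, hc.domRestrict⟩
  refine hφ (h 0) H ((flowDefect_eq_zero_iff hT).2 fun t => ?_)
  exact eq_initial_add_primitive hT (g := superposition G H) (h := h) (fun t ht => hh t ht) t

end Flow

/-! ### Scalar neural ODEs -/

section NeuralODE

variable {d m k : ℕ} {T : ℝ} {f : ℝ → (Fin m → ℝ) → (Fin m → ℝ)}

/-- The affine layer `x ↦ W x + b`. -/
def affineLayer (W : Matrix (Fin m) (Fin d) ℝ) (b : Fin m → ℝ)
    (x : EuclideanSpace ℝ (Fin d)) : Fin m → ℝ := W.mulVec x.ofLp + b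

theorem hasFDerivAt_affineLayer (W : Matrix (Fin m) (Fin d) ℝ) (b : Fin m → ℝ)
    (x : EuclideanSpace ℝ (Fin d)) :
    ∃ L : EuclideanSpace ℝ (Fin d) →L[ℝ] (Fin m → ℝ),
      HasFDerivAt (affineLayer W b) L x ∧ ∀ v, L v = W.mulVec v.ofLp := by
  let L : EuclideanSpace ℝ (Fin d) →L[ℝ] (Fin m → ℝ) := LinearMap.toContinuousLinearMap
    (W.mulVecLin ∘ₗ (WithLp.linearEquiv 2 ℝ (Fin d → ℝ)).toLinearMap)
  exact ⟨L, L.hasFDerivAt.add_const b, fun v => rfl⟩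

theorem contDiff_affineLayer_uncurry (b : Fin m → ℝ) {n : WithTop ℕ∞} :
    ContDiff ℝ n fun q : (Fin m → Fin d → ℝ) × EuclideanSpace ℝ (Fin d) =>
      affineLayer (Matrix.of q.1) b q.2 :=
  (MLPArch.contDiff_mulVec contDiff_fst (PiLp.contDiff_ofLp.comp contDiff_snd)).add contDiff_const

/-- The input-output map of a neural ODE is the composition of its affine layers with the flow. -/
theorem IsC0kVectorField.exists_neuralODE_eq (hk : 1 ≤ k) (hT : 0 ≤ T)
    (hf : IsC0kVectorField k T f) :
    ∃ (U : Set (Fin m → ℝ)) (φ : (Fin m → ℝ) → (Fin m → ℝ)),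
      (∀ p ∈ U, ContDiffAt ℝ k φ p ∧ Function.Injective (fderiv ℝ φ p)) ∧
      ∀ (W : Matrix (Fin m) (Fin d) ℝ) (b : Fin m → ℝ) (W' : Matrix (Fin 1) (Fin m) ℝ)
        (b' : Fin 1 → ℝ) (Φ : EuclideanSpace ℝ (Fin d) → ℝ), IsNeuralODEMap T f W b W' b' Φ →
        (∀ x, affineLayer W b x ∈ U) ∧
          Φ = fun x => W'.mulVec (φ (affineLayer W b x)) 0 + b' 0 := by
  obtain ⟨U, φ, hU, hφ⟩ := hf.exists_flow hk hT
  refine ⟨U, φ, hU, fun W b W' b' Φ hΦ => ?_⟩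
  obtain ⟨h, hh⟩ := hΦ
  have key : ∀ x, affineLayer W b x ∈ U ∧ h x T = φ (affineLayer W b x) := fun x => by
    have := hφ (h x) (hh x).2.1
    rwa [(hh x).1] at this
  refine ⟨fun x => (key x).1, funext fun x => ?_⟩
  rw [(hh x).2.2, (key x).2]
  rfl

theorem fderiv_scalar_readout (hk : 1 ≤ k) {φ : (Fin m → ℝ) → (Fin m → ℝ)}
    (W : Matrix (Fin m) (Fin d) ℝ) (b : Fin m → ℝ) (W' : Matrix (Fin 1) (Fin m) ℝ) (c : ℝ)
    {x : EuclideanSpace ℝ (Fin d)} (hφ : ContDiffAt ℝ k φ (affineLayer W b x))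
    (v : EuclideanSpace ℝ (Fin d)) :
    fderiv ℝ (fun x => W'.mulVec (φ (affineLayer W b x)) 0 + c) x v =
      W'.mulVec (fderiv ℝ φ (affineLayer W b x) (W.mulVec v.ofLp)) 0 := by
  obtain ⟨L, hL, hLv⟩ := hasFDerivAt_affineLayer W b x
  let R : (Fin m → ℝ) →L[ℝ] ℝ := LinearMap.toContinuousLinearMap
    ((LinearMap.proj (0 : Fin 1)) ∘ₗ W'.mulVecLin)
  have hφd := (hφ.differentiableAt (by exact_mod_cast (by omega : k ≠ 0))).hasFDerivAt
  have h1 : HasFDerivAt (fun x => W'.mulVec (φ (affineLayer W b x)) 0 + c)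
      (R.comp ((fderiv ℝ φ (affineLayer W b x)).comp L)) x :=
    (R.hasFDerivAt.comp x (hφd.comp x hL)).add_const c
  rw [h1.fderiv, ContinuousLinearMap.comp_apply, ContinuousLinearMap.comp_apply, hLv]
  rfl

theorem contDiffAt_mulVec_flow {n : WithTop ℕ∞} {φ : (Fin m → ℝ) → (Fin m → ℝ)} (b : Fin m → ℝ)
    (c : ℝ) {V : (Fin m → Fin d → ℝ) × (Fin 1 → Fin m → ℝ)} {x : EuclideanSpace ℝ (Fin d)}
    (hφ : ContDiffAt ℝ n φ (affineLayer (Matrix.of V.1) b x)) :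
    ContDiffAt ℝ n (fun q : ((Fin m → Fin d → ℝ) × (Fin 1 → Fin m → ℝ)) ×
      EuclideanSpace ℝ (Fin d) =>
        (Matrix.of q.1.2).mulVec (φ (affineLayer (Matrix.of q.1.1) b q.2)) 0 + c) (V, x) := by
  have h1 : ContDiffAt ℝ n (fun q : ((Fin m → Fin d → ℝ) × (Fin 1 → Fin m → ℝ)) ×
      EuclideanSpace ℝ (Fin d) => affineLayer (Matrix.of q.1.1) b q.2) (V, x) :=
    ((contDiff_affineLayer_uncurry b).comp
      (contDiff_fst.fst.prodMk contDiff_snd)).contDiffAt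
  have h2 := ContDiffAt.comp (V, x) (f := fun q : ((Fin m → Fin d → ℝ) × (Fin 1 → Fin m → ℝ)) ×
      EuclideanSpace ℝ (Fin d) => affineLayer (Matrix.of q.1.1) b q.2) (g := φ) hφ h1
  have h3 : ContDiff ℝ n fun q : (Fin 1 → Fin m → ℝ) × (Fin m → ℝ) =>
      (Matrix.of q.1).mulVec q.2 0 :=
    contDiff_pi.1 (MLPArch.contDiff_mulVec contDiff_fst contDiff_snd) 0
  exact (h3.contDiffAt.comp (V, x) (contDiffAt_fst.snd.prodMk h2)).add contDiffAt_const

theorem contDiff_scalar_readout {φ : (Fin m → ℝ) → (Fin m → ℝ)} {n : WithTop ℕ∞}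
    (W : Matrix (Fin m) (Fin d) ℝ) (b : Fin m → ℝ) (W' : Matrix (Fin 1) (Fin m) ℝ) (c : ℝ)
    (hφ : ∀ x, ContDiffAt ℝ n φ (affineLayer W b x)) :
    ContDiff ℝ n fun x => W'.mulVec (φ (affineLayer W b x)) 0 + c :=
  contDiff_iff_contDiffAt.2 fun x =>
    (contDiffAt_mulVec_flow (V := (Matrix.of.symm W, Matrix.of.symm W')) b c (hφ x)).comp x
      (contDiff_prodMk_right (Matrix.of.symm W, Matrix.of.symm W')).contDiffAt

/-- The differential is a composition of surjections: an injective endomorphism of `ℝ^m` is onto,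
and so are the two matrices of full rank. -/
theorem neuralODE_mem_classC1 (hk : 1 ≤ k) (hm : 1 ≤ m) (hmd : m ≤ d) (hT : 0 ≤ T)
    (hf : IsC0kVectorField k T f) {W : Matrix (Fin m) (Fin d) ℝ} {b : Fin m → ℝ}
    {W' : Matrix (Fin 1) (Fin m) ℝ} {b' : Fin 1 → ℝ} (hW : FullRank W) (hW' : FullRank W')
    {Φ : EuclideanSpace ℝ (Fin d) → ℝ} (hΦ : IsNeuralODEMap T f W b W' b' Φ) :
    Φ ∈ classC1 k d := by
  obtain ⟨U, φ, hU, hφ⟩ := hf.exists_neuralODE_eq (d := d) hk hT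
  obtain ⟨hxU, rfl⟩ := hφ W b W' b' Φ hΦ
  refine mem_classC1_iff.2
    ⟨contDiff_scalar_readout W b W' _ fun x => (hU _ (hxU x)).1, fun x hx => ?_⟩
  obtain ⟨w, hw⟩ := hW'.mulVec_surjective hm fun _ => 1
  have hs : Function.Surjective (fderiv ℝ φ (affineLayer W b x)) :=
    LinearMap.injective_iff_surjective.1 (hU _ (hxU x)).2
  obtain ⟨u, hu⟩ := hs w
  obtain ⟨v, hv⟩ := hW.mulVec_surjective hmd u
  have h1 := fderiv_scalar_readout hk W b W' (b' 0) (hU _ (hxU x)).1 (WithLp.toLp 2 v)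
  rw [hx] at h1
  simp [hv, hu, hw] at h1

/-- For almost every `W` the map `v ↦ W v` is injective, so with the injective differential of the
flow every `v ≠ 0` reaches the readout as a nonzero vector `p`. Varying `W̃` alone then gives
transversality. -/
theorem ae_neuralODE_mem_classC1_union_classC2 (hk : 2 ≤ k) (hmd : d ≤ m) (hT : 0 ≤ T)
    (hf : IsC0kVectorField k T f) (b : Fin m → ℝ) (b' : Fin 1 → ℝ) :
    ∀ᵐ V : (Fin m → Fin d → ℝ) × (Fin 1 → Fin m → ℝ),
      ∀ Φ, IsNeuralODEMap T f (Matrix.of V.1) b (Matrix.of V.2) b' Φ →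
        Φ ∈ classC1 k d ∪ classC2 k d := by
  have hk1 : 1 ≤ k := by omega
  obtain ⟨U, φ, hU, hφ⟩ := hf.exists_neuralODE_eq (d := d) hk1 hT
  have := MLPArch.isAddHaarMeasure_volume_matrix_prod m d 1 m
  filter_upwards [ae_nondegenerate_of_transverse volume
    (fun (V : (Fin m → Fin d → ℝ) × (Fin 1 → Fin m → ℝ)) (x : EuclideanSpace ℝ (Fin d)) =>
      (Matrix.of V.2).mulVec (φ (affineLayer (Matrix.of V.1) b x)) 0 + b' 0),
    Measure.quasiMeasurePreserving_fst.ae (ae_fullRank m d)] with V hV hrank Φ hΦ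
  obtain ⟨hxU, rfl⟩ := hφ _ b _ b' Φ hΦ
  refine mem_classC1_union_classC2 hk
    (contDiff_scalar_readout _ b _ _ fun x => (hU _ (hxU x)).1) fun x hx => ?_
  have hx1 := (hU _ (hxU x)).1
  refine hV x (contDiffAt_mulVec_flow b (b' 0) (hx1.of_le (by exact_mod_cast hk))) hx
    fun v hv => ?_
  set p := fderiv ℝ φ (affineLayer (Matrix.of V.1) b x) ((Matrix.of V.1).mulVec v.ofLp)
  have hp : p ≠ 0 := fun h => hv <| by
    have h1 := (hU _ (hxU x)).2 (h.trans (map_zero _).symm)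
    have h2 := hrank.mulVec_injective hmd (h1.trans (Matrix.mulVec_zero _).symm)
    ext i
    exact congrFun h2 i
  -- Adding `t` times the row `p` to `W̃` changes `dΦ(x) v` by `t * (p ⬝ᵥ p)`.
  refine ⟨(0, fun _ => p), p ⬝ᵥ p, (dotProduct_self_eq_zero.not).2 hp, ?_⟩
  have h1 : (fun t : ℝ => fderiv ℝ (fun x => (Matrix.of (V + t • ((0, fun _ => p) :
      (Fin m → Fin d → ℝ) × (Fin 1 → Fin m → ℝ))).2).mulVec (φ (affineLayer
        (Matrix.of (V + t • ((0, fun _ => p) : (Fin m → Fin d → ℝ) × (Fin 1 → Fin m → ℝ))).1)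
          b x)) 0 + b' 0) x v) = fun t => (Matrix.of V.2).mulVec p 0 + t * (p ⬝ᵥ p) := by
    ext1 t
    have h0 : (V + t • ((0, fun _ => p) : (Fin m → Fin d → ℝ) × (Fin 1 → Fin m → ℝ))).1 = V.1 := by
      simp
    rw [h0, fderiv_scalar_readout hk1 _ b _ (b' 0) hx1]
    simp only [Matrix.mulVec, Matrix.of_apply, Prod.snd_add, Prod.smul_snd, Pi.add_apply,
      Pi.smul_apply]
    rw [← smul_eq_mul, ← smul_dotProduct, ← add_dotProduct]
    rfl
  rw [h1]
  have h2 : HasDerivAt (fun t : ℝ => t * (p ⬝ᵥ p)) (1 * (p ⬝ᵥ p)) 0 :=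
    (hasDerivAt_id (0 : ℝ)).mul_const _
  rw [one_mul] at h2
  exact h2.const_add _

/-- The differential is constant along the lines in direction `v`, so the Hessian annihilates `v`,
in particular at a critical point. -/
theorem mem_classC1_union_classC3_of_invariant (hk : 2 ≤ k) {Φ : EuclideanSpace ℝ (Fin d) → ℝ}
    (hΦ : ContDiff ℝ k Φ) {v : EuclideanSpace ℝ (Fin d)} (hv : v ≠ 0)
    (hinv : ∀ x (t : ℝ), Φ (x + t • v) = Φ x) : Φ ∈ classC1 k d ∪ classC3 k d := by
  by_cases hc : ∃ x, fderiv ℝ Φ x = 0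
  · obtain ⟨x, hx⟩ := hc
    refine Or.inr (mem_classC3_of hk hΦ hx hv ?_)
    have h2 : ContDiff ℝ 2 Φ := hΦ.of_le (by exact_mod_cast hk)
    have hd : Differentiable ℝ (fderiv ℝ Φ) :=
      (h2.fderiv_right (m := 1) (by norm_num)).differentiable one_ne_zero
    have h1 : HasDerivAt (fun t : ℝ => x + t • v) v 0 := by
      simpa using ((hasDerivAt_id (0 : ℝ)).smul_const v).const_add x
    have h3 : HasFDerivAt (fderiv ℝ Φ) (fderiv ℝ (fderiv ℝ Φ) x) (x + (0 : ℝ) • v) := by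
      simpa using (hd x).hasFDerivAt
    have h4 : HasDerivAt (fun t : ℝ => fderiv ℝ Φ (x + t • v)) (fderiv ℝ (fderiv ℝ Φ) x v) 0 :=
      HasFDerivAt.comp_hasDerivAt (f := fun t : ℝ => x + t • v) (0 : ℝ) h3 h1
    have h5 : (fun t : ℝ => fderiv ℝ Φ (x + t • v)) = fun _ => fderiv ℝ Φ x := by
      ext1 t
      rw [← fderiv_comp_add_right]
      simp only [hinv]
    rw [h5] at h4
    exact h4.unique (hasDerivAt_const _ _)
  · exact Or.inl (mem_classC1_iff.2 ⟨hΦ, not_exists.1 hc⟩)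

/-- If `W` is rank deficient, `Φ` is invariant along a kernel vector. If the single row `W̃` is rank
deficient, it is zero and `Φ` is constant. -/
theorem degenerate_neuralODE_mem_classC1_union_classC3 (hk : 2 ≤ k) (hd : 1 ≤ d) (hm : 1 ≤ m)
    (hT : 0 ≤ T) (hf : IsC0kVectorField k T f) {W : Matrix (Fin m) (Fin d) ℝ} {b : Fin m → ℝ}
    {W' : Matrix (Fin 1) (Fin m) ℝ} {b' : Fin 1 → ℝ} (hW : ¬ FullRank W ∨ ¬ FullRank W')
    {Φ : EuclideanSpace ℝ (Fin d) → ℝ} (hΦ : IsNeuralODEMap T f W b W' b' Φ) :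
    Φ ∈ classC1 k d ∪ classC3 k d := by
  have hk1 : 1 ≤ k := by omega
  obtain ⟨U, φ, hU, hφ⟩ := hf.exists_neuralODE_eq (d := d) hk1 hT
  obtain ⟨hxU, rfl⟩ := hφ W b W' b' Φ hΦ
  have hsmooth := contDiff_scalar_readout W b W' (b' 0) fun x => (hU _ (hxU x)).1
  rcases hW with hW | hW'
  · obtain ⟨v, hv0, hv⟩ := exists_mulVec_eq_zero_of_not_fullRank hW
    refine mem_classC1_union_classC3_of_invariant hk hsmooth (v := WithLp.toLp 2 v)
      (fun h => hv0 (congrArg WithLp.ofLp h)) fun x t => ?_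
    have : affineLayer W b (x + t • WithLp.toLp 2 v) = affineLayer W b x := by
      simp [affineLayer, Matrix.mulVec_add, Matrix.mulVec_smul, hv]
    rw [this]
  · have h0 : W' = 0 := by
      have h1 : W'.rank = 0 := by
        have h1 := W'.rank_le_height
        unfold FullRank at hW'
        omega
      have h2 : W'.mulVecLin = 0 := LinearMap.range_eq_bot.1 (Submodule.finrank_eq_zero.1 h1)
      exact Matrix.mulVec_injective (funext fun v =>
        (LinearMap.congr_fun h2 v).trans (Matrix.zero_mulVec v).symm)
    refine mem_classC1_union_classC3_of_invariant hk hsmooth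
      (v := EuclideanSpace.single ⟨0, hd⟩ 1) (by simp) fun x t => ?_
    simp [h0]

end NeuralODE

/-! ### Bottleneck architectures of every class -/

/-- The scalar function computed by the last layers of `bottleneckArch`. -/
noncomputable def expTower (s : ℝ) : ℝ :=
  Real.exp (2 * Real.exp (Real.exp (2 * Real.exp s)))

/-- A nonvanishing derivative ensures that composing with `expTower` neither creates nor removes
critical points. The factors `2` in the tower arise from the layers of width two, whose equal
entries are summed. -/
theorem hasDerivAt_expTower (s : ℝ) : ∃ c, c ≠ 0 ∧ HasDerivAt expTower c s := by
  have h1 : ∀ {u : ℝ → ℝ} {c : ℝ}, c ≠ 0 ∧ HasDerivAt u c s →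
      ∃ c, c ≠ 0 ∧ HasDerivAt (fun s => Real.exp (u s)) c s := fun {u c} h =>
    ⟨_, mul_ne_zero (Real.exp_ne_zero (u s)) h.1, h.2.exp⟩
  have h2 : ∀ {u : ℝ → ℝ} {c : ℝ}, c ≠ 0 ∧ HasDerivAt u c s →
      ∃ c, c ≠ 0 ∧ HasDerivAt (fun s => 2 * u s) c s := fun {u c} h =>
    ⟨_, mul_ne_zero two_ne_zero h.1, h.2.const_mul 2⟩
  obtain ⟨_, a⟩ := h1 ⟨one_ne_zero, hasDerivAt_id s⟩
  obtain ⟨_, a⟩ := h2 a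
  obtain ⟨_, a⟩ := h1 a
  obtain ⟨_, a⟩ := h1 a
  obtain ⟨_, a⟩ := h2 a
  exact h1 a

theorem contDiff_expTower {n : WithTop ℕ∞} : ContDiff ℝ n expTower := by
  unfold expTower
  fun_prop

namespace MLPArch

/-- The architecture with layer widths `d, 1, 2, 1, 2, 1`. -/
def bottleneckArch (d : ℕ) (hd : 1 ≤ d) : MLPArch where
  L := 5
  width := ![d, 1, 2, 1, 2, 1]
  inner := ![d + d, 1, 1, 1, 1]
  width_pos := by
    intro l
    fin_cases l <;> simp; omega
  inner_pos := by
    intro l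
    fin_cases l <;> simp; omega
  width_last := rfl

/-- The activation functions of the first layer are `σ`, `d` times, and `τ`, `d` times; all others
are `exp`. -/
noncomputable def bottleneckParams (d : ℕ) (hd : 1 ≤ d) (σ τ : ℝ → ℝ) :
    (bottleneckArch d hd).Params where
  act l i := if l.1 = 0 then if i.1 < d then σ else τ else Real.exp
  bias _ _ := 0
  outBias _ _ := 0

/-- The first matrix consists of two identity blocks, all other matrices have the entries `1`. -/
noncomputable def bottleneckWeights (d : ℕ) (hd : 1 ≤ d) : (bottleneckArch d hd).Weights :=
  fun l => (fun i j => if l.1 = 0 then if i.1 % d = j.1 then 1 else 0 else 1, fun _ _ => 1)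

theorem isBottleneck_of_width {A : MLPArch} (h : BottleneckWidths A.width) : A.IsBottleneck := by
  obtain ⟨i, b, j, hib, hbj, hwi, hwj⟩ := h
  refine ⟨⟨2 * i.1, by omega⟩, ⟨2 * b.1, by omega⟩, ⟨2 * j.1, by omega⟩, ?_, ?_, ?_, ?_⟩
  · simpa using hib
  · simpa using hbj
  · rwa [allWidths_even, allWidths_even]
  · rwa [allWidths_even, allWidths_even]

theorem bottleneckArch_bottleneckWidths (d : ℕ) (hd : 1 ≤ d) :
    BottleneckWidths (bottleneckArch d hd).width := by
  have h2 : 2 < 6 := by decide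
  have h3 : 3 < 6 := by decide
  have h4 : 4 < 6 := by decide
  exact ⟨⟨2, h2⟩, ⟨3, h3⟩, ⟨4, h4⟩, Fin.mk_lt_mk.2 (by decide), Fin.mk_lt_mk.2 (by decide),
    Nat.one_lt_two, Nat.one_lt_two⟩

theorem bottleneckParams_isAdmissible {d k : ℕ} (hd : 1 ≤ d) {σ τ : ℝ → ℝ} (hσ : ContDiff ℝ k σ)
    (hσ' : ∀ s, deriv σ s ≠ 0) (hτ : ContDiff ℝ k τ) (hτ' : ∀ s, deriv τ s ≠ 0) :
    (bottleneckParams d hd σ τ).IsAdmissible k := by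
  intro l i
  simp only [bottleneckParams]
  split_ifs
  · exact ⟨hσ, hσ'⟩
  · exact ⟨hτ, hτ'⟩
  · exact ⟨Real.contDiff_exp, by simp⟩

theorem not_affine_exp : ¬ ∃ a c : ℝ, ∀ s, Real.exp s = a * s + c := by
  rintro ⟨a, c, h⟩
  have h1 : deriv Real.exp = fun _ => a := by
    rw [funext h]
    ext s
    simp
  rw [Real.deriv_exp] at h1
  have h2 := congrFun h1 0
  have h3 := congrFun h1 1
  rw [← h2] at h3
  exact absurd (Real.exp_injective h3) one_ne_zero

theorem bottleneckParams_isNonlinear {d : ℕ} (hd : 1 ≤ d) {σ τ : ℝ → ℝ}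
    (hσ : ¬ ∃ a c : ℝ, ∀ s, σ s = a * s + c) (hτ : ¬ ∃ a c : ℝ, ∀ s, τ s = a * s + c) :
    (bottleneckParams d hd σ τ).IsNonlinear := by
  intro l i
  simp only [bottleneckParams]
  split_ifs
  · exact hσ
  · exact hτ
  · exact not_affine_exp

theorem fullRank_ones_row {n : ℕ} (hn : 1 ≤ n) :
    FullRank (Matrix.of fun (_ : Fin 1) (_ : Fin n) => (1 : ℝ)) := by
  refine FullRank.of_mulVec_surjective hn fun w => ⟨Pi.single ⟨0, hn⟩ (w 0), ?_⟩
  ext i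
  simp [Matrix.mulVec, dotProduct, Subsingleton.elim i 0]

theorem fullRank_ones_column {n : ℕ} (hn : 1 ≤ n) :
    FullRank (Matrix.of fun (_ : Fin n) (_ : Fin 1) => (1 : ℝ)) := by
  refine FullRank.of_mulVec_injective hn fun v w h => ?_
  ext i
  have := congrFun h ⟨0, hn⟩
  simpa [Matrix.mulVec, dotProduct, Subsingleton.elim i 0] using this

theorem fullRank_identity_blocks (d : ℕ) :
    FullRank (Matrix.of fun (i : Fin (d + d)) (j : Fin d) =>
      if i.1 % d = j.1 then (1 : ℝ) else 0) := by
  refine FullRank.of_mulVec_injective (by omega) fun v w h => ?_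
  ext i
  have := congrFun h (Fin.castAdd d i)
  simpa [Matrix.mulVec, dotProduct, Nat.mod_eq_of_lt i.2, Fin.val_inj] using this

theorem bottleneckWeights_isFullRank (d : ℕ) (hd : 1 ≤ d) :
    (bottleneckWeights d hd).IsFullRank := by
  intro l
  change Fin 5 at l
  fin_cases l
  · exact ⟨fullRank_identity_blocks d, fullRank_ones_row (by omega : 1 ≤ d + d)⟩
  · exact ⟨fullRank_ones_row le_rfl, fullRank_ones_column (by omega : 1 ≤ 2)⟩
  · exact ⟨fullRank_ones_row (by omega : 1 ≤ 2), fullRank_ones_row le_rfl⟩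
  · exact ⟨fullRank_ones_row le_rfl, fullRank_ones_column (by omega : 1 ≤ 2)⟩
  · exact ⟨fullRank_ones_row (by omega : 1 ≤ 2), fullRank_ones_row le_rfl⟩

theorem mulVec_ones_const {m n : ℕ} (a : ℝ) :
    (Matrix.of fun (_ : Fin m) (_ : Fin n) => (1 : ℝ)).mulVec (fun _ => a) = fun _ => n * a := by
  ext i
  simp [Matrix.mulVec, dotProduct]

theorem sum_identity_blocks {d : ℕ} (σ τ : ℝ → ℝ) (x : Fin d → ℝ) :
    ∑ i : Fin (d + d), (if i.1 < d then σ else τ) ((Matrix.of fun (i : Fin (d + d)) (j : Fin d) =>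
      if i.1 % d = j.1 then (1 : ℝ) else 0).mulVec x i) = ∑ i, (σ (x i) + τ (x i)) := by
  rw [Fin.sum_univ_add, Finset.sum_add_distrib]
  congr 1 <;> refine Finset.sum_congr rfl fun i _ => ?_ <;>
    simp [Matrix.mulVec, dotProduct, Nat.mod_eq_of_lt i.2, Fin.val_inj]

/-- After the first layer all weights are `1`, so every layer has equal entries and is described by
one number `s`; a step from a layer of width `n` replaces it by `exp (n * s)`. -/
theorem bottleneck_map_eq {d : ℕ} (hd : 1 ≤ d) (σ τ : ℝ → ℝ) :
    (bottleneckArch d hd).map (bottleneckParams d hd σ τ) (bottleneckWeights d hd) =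
      fun x : EuclideanSpace ℝ (Fin d) => expTower (∑ i, (σ (x i) + τ (x i))) := by
  funext x
  change EuclideanSpace ℝ (Fin d) at x
  let A := bottleneckArch d hd
  let P := bottleneckParams d hd σ τ
  let θ := bottleneckWeights d hd
  have ones : ∀ {m n : ℕ} (s : ℝ), (Matrix.of fun (_ : Fin m) (_ : Fin 1) => (1 : ℝ)).mulVec
      (fun _ : Fin 1 => Real.exp (((Matrix.of fun (_ : Fin 1) (_ : Fin n) => (1 : ℝ)).mulVec
        (fun _ => s) + 0) (0 : Fin 1))) + 0 = fun _ : Fin m => Real.exp (n * s) := by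
    intro m n s
    rw [mulVec_ones_const, mulVec_ones_const]
    ext i
    simp
  have step : ∀ {m n : ℕ} {h : Fin n → ℝ} {s : ℝ}, h = (fun _ => s) →
      ((Matrix.of fun (_ : Fin m) (_ : Fin 1) => (1 : ℝ)).mulVec
        (fun i : Fin 1 => Real.exp (((Matrix.of fun (_ : Fin 1) (_ : Fin n) => (1 : ℝ)).mulVec
          h + 0) i)) + 0) = fun _ : Fin m => Real.exp (n * s) := by
    rintro m n h s rfl
    rw [← ones s]
    congr 3
  have l1 : 1 < 6 := by decide
  have l2 : 2 < 6 := by decide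
  have l3 : 3 < 6 := by decide
  have l4 : 4 < 6 := by decide
  have l5 : 5 < 6 := by decide
  have h1 : A.layer P θ x.ofLp ⟨1, l1⟩ =
      fun _ : Fin 1 => ∑ i, (σ (x i) + τ (x i)) := by
    rw [← sum_identity_blocks]
    change (Matrix.of fun (_ : Fin 1) (_ : Fin (d + d)) => (1 : ℝ)).mulVec
      (fun i => (if i.1 < d then σ else τ) (((Matrix.of fun (i : Fin (d + d)) (j : Fin d) =>
        if i.1 % d = j.1 then (1 : ℝ) else 0).mulVec x.ofLp + 0) i)) + 0 = _
    ext i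
    rw [add_zero, add_zero]
    simp only [Matrix.mulVec, dotProduct, Matrix.of_apply, one_mul]
  have h2 : A.layer P θ x.ofLp ⟨2, l2⟩ = fun _ : Fin 2 => _ := step (m := 2) (n := 1) h1
  have h3 : A.layer P θ x.ofLp ⟨3, l3⟩ = fun _ : Fin 1 => _ := step (m := 1) (n := 2) h2
  have h4 : A.layer P θ x.ofLp ⟨4, l4⟩ = fun _ : Fin 2 => _ := step (m := 2) (n := 1) h3
  have h5 : A.layer P θ x.ofLp ⟨5, l5⟩ = fun _ : Fin 1 => _ := step (m := 1) (n := 2) h4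
  refine (congrFun h5 (0 : Fin 1)).trans ?_
  simp [expTower]

/-! #### The class of a separable function -/

theorem hasFDerivAt_separable {d : ℕ} {g : ℝ → ℝ} (hg : Differentiable ℝ g)
    (x : EuclideanSpace ℝ (Fin d)) :
    HasFDerivAt (fun x : EuclideanSpace ℝ (Fin d) => ∑ i, g (x i))
      (∑ i, deriv g (x i) • (EuclideanSpace.proj i : EuclideanSpace ℝ (Fin d) →L[ℝ] ℝ)) x :=
  HasFDerivAt.fun_sum fun i _ => (hg (x i)).hasDerivAt.comp_hasFDerivAt x
    (EuclideanSpace.proj i : EuclideanSpace ℝ (Fin d) →L[ℝ] ℝ).hasFDerivAt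

theorem fderiv_expTower_separable {d : ℕ} {g : ℝ → ℝ} (hg : Differentiable ℝ g)
    (x v : EuclideanSpace ℝ (Fin d)) :
    fderiv ℝ (fun x : EuclideanSpace ℝ (Fin d) => expTower (∑ i, g (x i))) x v =
      deriv expTower (∑ i, g (x i)) * ∑ i, deriv g (x i) * v i := by
  have h1 : HasDerivAt expTower (deriv expTower (∑ i, g (x i))) (∑ i, g (x i)) := by
    obtain ⟨c, -, hc⟩ := hasDerivAt_expTower (∑ i, g (x i))
    exact hc.differentiableAt.hasDerivAt
  have h2 := h1.comp_hasFDerivAt x (hasFDerivAt_separable hg x)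
  rw [show (fun x : EuclideanSpace ℝ (Fin d) => expTower (∑ i, g (x i))) =
    expTower ∘ fun x : EuclideanSpace ℝ (Fin d) => ∑ i, g (x i) from rfl, h2.fderiv]
  simp [sum_apply]

theorem deriv_expTower_ne_zero (s : ℝ) : deriv expTower s ≠ 0 := by
  obtain ⟨c, hc0, hc⟩ := hasDerivAt_expTower s
  rwa [hc.deriv]

/-- A point is critical for `expTower (∑ i, g (x i))` if and only if all `g' (x i)` vanish. -/
theorem fderiv_expTower_separable_eq_zero_iff {d : ℕ} {g : ℝ → ℝ} (hg : Differentiable ℝ g)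
    (x : EuclideanSpace ℝ (Fin d)) :
    fderiv ℝ (fun x : EuclideanSpace ℝ (Fin d) => expTower (∑ i, g (x i))) x = 0 ↔
      ∀ i, deriv g (x i) = 0 := by
  constructor
  · intro h i
    have h1 := fderiv_expTower_separable hg x (EuclideanSpace.single i 1)
    rw [h] at h1
    simpa [deriv_expTower_ne_zero, Pi.single_apply] using h1.symm
  · intro h
    ext v
    rw [fderiv_expTower_separable hg]
    simp [h]

/-- At a critical point, the Hessian of `expTower (∑ i, g (x i))` is diagonal, with entries
proportional to `g'' (x i)`. -/
theorem fderiv_fderiv_expTower_separable {d : ℕ} {g : ℝ → ℝ} (hg : ContDiff ℝ 2 g)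
    {x : EuclideanSpace ℝ (Fin d)} (hx : ∀ i, deriv g (x i) = 0)
    (u v : EuclideanSpace ℝ (Fin d)) :
    fderiv ℝ (fderiv ℝ fun x : EuclideanSpace ℝ (Fin d) => expTower (∑ i, g (x i))) x u v =
      deriv expTower (∑ i, g (x i)) * ∑ i, deriv (deriv g) (x i) * u i * v i := by
  have hgd : Differentiable ℝ g := hg.differentiable two_ne_zero
  have hg2 : Differentiable ℝ (deriv g) :=
    ((contDiff_succ_iff_deriv (n := 1)).1 hg).2.2.differentiable one_ne_zero
  have hΨ : ContDiff ℝ 2 fun x : EuclideanSpace ℝ (Fin d) => expTower (∑ i, g (x i)) :=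
    contDiff_expTower.comp (ContDiff.sum fun i _ => hg.comp (by fun_prop))
  have hF : DifferentiableAt ℝ
      (fderiv ℝ fun x : EuclideanSpace ℝ (Fin d) => expTower (∑ i, g (x i))) x :=
    ((hΨ.fderiv_right (m := 1) (by norm_num)).differentiable one_ne_zero) x
  have h1 : HasDerivAt (fun t : ℝ => x + t • u) u 0 := by
    simpa using ((hasDerivAt_id (0 : ℝ)).smul_const u).const_add x
  have h1i : ∀ i, HasDerivAt (fun t : ℝ => (x + t • u) i) (u i) 0 := fun i => by
    simpa using ((hasDerivAt_id (0 : ℝ)).mul_const (u i)).const_add (x i)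
  have hF0 : HasFDerivAt
      (fderiv ℝ fun x : EuclideanSpace ℝ (Fin d) => expTower (∑ i, g (x i)))
      (fderiv ℝ (fderiv ℝ fun x : EuclideanSpace ℝ (Fin d) => expTower (∑ i, g (x i))) x)
      (x + (0 : ℝ) • u) := by
    simpa using hF.hasFDerivAt
  have h2 : HasDerivAt (fun t : ℝ =>
      fderiv ℝ (fun x : EuclideanSpace ℝ (Fin d) => expTower (∑ i, g (x i))) (x + t • u))
      (fderiv ℝ (fderiv ℝ fun x : EuclideanSpace ℝ (Fin d) => expTower (∑ i, g (x i))) x u) 0 :=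
    HasFDerivAt.comp_hasDerivAt (f := fun t : ℝ => x + t • u) (0 : ℝ) hF0 h1
  have h3 : HasDerivAt (fun t : ℝ =>
      fderiv ℝ (fun x : EuclideanSpace ℝ (Fin d) => expTower (∑ i, g (x i))) (x + t • u) v)
      (fderiv ℝ (fderiv ℝ fun x : EuclideanSpace ℝ (Fin d) => expTower (∑ i, g (x i))) x u v)
      0 := by
    simpa using h2.clm_apply (hasDerivAt_const (0 : ℝ) v)
  have hdT : Differentiable ℝ (deriv expTower) :=
    ((contDiff_succ_iff_deriv (n := 1)).1 (contDiff_expTower (n := 2))).2.2.differentiable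
      one_ne_zero
  have h4 : DifferentiableAt ℝ (fun t : ℝ => deriv expTower (∑ i, g ((x + t • u) i))) 0 :=
    DifferentiableAt.comp (0 : ℝ) (hdT _) (DifferentiableAt.fun_sum fun i _ =>
      DifferentiableAt.comp (0 : ℝ) (hgd _) (h1i i).differentiableAt)
  have h5 : HasDerivAt (fun t : ℝ => ∑ i, deriv g ((x + t • u) i) * v i)
      (∑ i, deriv (deriv g) (x i) * u i * v i) 0 :=
    HasDerivAt.fun_sum fun i _ => by
      have h6 : HasDerivAt (deriv g) (deriv (deriv g) (x i)) ((x + (0 : ℝ) • u) i) := by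
        simpa using (hg2 (x i)).hasDerivAt
      exact (h6.comp (0 : ℝ) (h1i i)).mul_const (v i)
  -- In the product rule, the term with the derivative of `deriv expTower` is multiplied by `∑ deriv
  -- g (x i) * v i`, which vanishes at a critical point.
  have h7 := h4.hasDerivAt.fun_mul h5
  simp only [fderiv_expTower_separable hgd] at h3
  rw [h3.unique h7]
  simp [hx]

/-- The class depends only on `g = σ + τ`, which need not be monotone although both summands are.
The class `C` is a family over all dimensions because the input dimension of the network is `A.width
0`. -/
theorem exists_bottleneck_mem_class {d k : ℕ} (hd : 1 ≤ d)
    (C : ∀ n : ℕ, Set (EuclideanSpace ℝ (Fin n) → ℝ)) {σ τ : ℝ → ℝ} (hσ : ContDiff ℝ k σ)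
    (hσ' : ∀ s, deriv σ s ≠ 0) (hτ : ContDiff ℝ k τ) (hτ' : ∀ s, deriv τ s ≠ 0)
    (hσa : ¬ ∃ a c : ℝ, ∀ s, σ s = a * s + c) (hτa : ¬ ∃ a c : ℝ, ∀ s, τ s = a * s + c)
    (hC : ContDiff ℝ k (fun x : EuclideanSpace ℝ (Fin d) => expTower (∑ i, (σ (x i) + τ (x i)))) →
      (fun x : EuclideanSpace ℝ (Fin d) => expTower (∑ i, (σ (x i) + τ (x i)))) ∈ C d) :
    ∃ (A : MLPArch) (P : A.Params) (θ : A.Weights),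
      A.width 0 = d ∧ A.IsBottleneck ∧ BottleneckWidths A.width ∧
      P.IsAdmissible k ∧ P.IsNonlinear ∧ θ.IsFullRank ∧ A.map P θ ∈ C (A.width 0) := by
  refine ⟨bottleneckArch d hd, bottleneckParams d hd σ τ, bottleneckWeights d hd, rfl,
    isBottleneck_of_width (bottleneckArch_bottleneckWidths d hd),
    bottleneckArch_bottleneckWidths d hd,
    bottleneckParams_isAdmissible hd hσ hσ' hτ hτ', bottleneckParams_isNonlinear hd hσa hτa,
    bottleneckWeights_isFullRank d hd, ?_⟩
  rw [bottleneck_map_eq hd σ τ]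
  exact hC (contDiff_expTower.comp (ContDiff.sum fun i _ =>
    (hσ.add hτ).comp (f := fun x : EuclideanSpace ℝ (Fin d) => x i) (by fun_prop)))

/-- Here `g = 2 exp`, whose derivative has no zero. -/
theorem exists_bottleneck_mem_classC1 {d k : ℕ} (hd : 1 ≤ d) :
    ∃ (A : MLPArch) (P : A.Params) (θ : A.Weights),
      A.width 0 = d ∧ A.IsBottleneck ∧ BottleneckWidths A.width ∧
      P.IsAdmissible k ∧ P.IsNonlinear ∧ θ.IsFullRank ∧ A.map P θ ∈ classC1 k (A.width 0) := by
  refine exists_bottleneck_mem_class hd (classC1 k) Real.contDiff_exp (by simp)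
    Real.contDiff_exp (by simp) not_affine_exp not_affine_exp fun hc =>
      mem_classC1_iff.2 ⟨hc, fun x hx => ?_⟩
  have h := (fderiv_expTower_separable_eq_zero_iff (g := fun s => Real.exp s + Real.exp s)
    (by fun_prop) x).1 hx ⟨0, hd⟩
  have h1 : deriv (fun s => Real.exp s + Real.exp s) (x ⟨0, hd⟩) =
      Real.exp (x ⟨0, hd⟩) + Real.exp (x ⟨0, hd⟩) :=
    ((Real.hasDerivAt_exp _).add (Real.hasDerivAt_exp _)).deriv
  rw [h1] at h
  have := Real.exp_pos (x ⟨0, hd⟩)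
  linarith

theorem not_affine_exp_neg : ¬ ∃ a c : ℝ, ∀ s, Real.exp (-s) = a * s + c := by
  rintro ⟨a, c, h⟩
  refine not_affine_exp ⟨-a, c, fun s => ?_⟩
  have := h (-s)
  rw [neg_neg] at this
  rw [this]
  ring

/-- Here `g s = exp s + exp (-s)`, with a critical point at `0` and `g'' = g > 0` everywhere, so the
diagonal Hessian is invertible at critical points. -/
theorem exists_bottleneck_mem_classC2 {d k : ℕ} (hk : 2 ≤ k) (hd : 1 ≤ d) :
    ∃ (A : MLPArch) (P : A.Params) (θ : A.Weights),
      A.width 0 = d ∧ A.IsBottleneck ∧ BottleneckWidths A.width ∧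
      P.IsAdmissible k ∧ P.IsNonlinear ∧ θ.IsFullRank ∧ A.map P θ ∈ classC2 k (A.width 0) := by
  have hneg : ∀ s : ℝ, HasDerivAt (fun s => Real.exp (-s)) (-Real.exp (-s)) s := fun s => by
    simpa using (hasDerivAt_neg s).exp
  have hg1 : deriv (fun s => Real.exp s + Real.exp (-s)) = fun s => Real.exp s - Real.exp (-s) :=
    funext fun s => by
      rw [((Real.hasDerivAt_exp s).fun_add (hneg s)).deriv, sub_eq_add_neg]
  have hg2 : ∀ s, deriv (fun s => Real.exp s - Real.exp (-s)) s = Real.exp s + Real.exp (-s) :=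
    fun s => by
      rw [((Real.hasDerivAt_exp s).fun_sub (hneg s)).deriv, sub_neg_eq_add]
  refine exists_bottleneck_mem_class hd (classC2 k) Real.contDiff_exp (by simp)
    (τ := fun s => Real.exp (-s)) (by fun_prop) (fun s => by
      rw [(hneg s).deriv]
      exact neg_ne_zero.2 (Real.exp_ne_zero _)) not_affine_exp not_affine_exp_neg fun hc => ?_
  have hcrit := fderiv_expTower_separable_eq_zero_iff (d := d)
    (g := fun s => Real.exp s + Real.exp (-s)) (by fun_prop)
  refine ⟨hc, ⟨0, gradient_eq_zero_iff.2 ((hcrit 0).2 fun i => by simp [hg1])⟩, fun q hq hdet => ?_⟩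
  have hq' := (hcrit q).1 (gradient_eq_zero_iff.1 hq)
  obtain ⟨v, hv0, hv⟩ := (det_hessianMatrix_eq_zero_iff hk hc q).1 hdet
  refine hv0 ?_
  have h1 := fderiv_fderiv_expTower_separable (g := fun s => Real.exp s + Real.exp (-s))
    (by fun_prop) hq' v
  ext i
  have h2 := h1 (EuclideanSpace.single i 1)
  rw [hv] at h2
  have h3 : Real.exp (q i) + Real.exp (-(q i)) ≠ 0 := by positivity
  simpa [deriv_expTower_ne_zero, hg1, hg2, Pi.single_apply, h3] using h2.symm

theorem not_affine_cubic {a b : ℝ} (hb : b ≠ 0) :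
    ¬ ∃ a' c : ℝ, ∀ s : ℝ, a * s + b * s ^ 3 = a' * s + c := by
  rintro ⟨a', c, h⟩
  -- The second difference over `0, 1, 2` is `6 * b` on the left and `0` on the right.
  have h0 := h 0
  have h1 := h 1
  have h2 := h 2
  exact hb (by linarith)

/-- The cubics `s + s ^ 3` and `-s - 2 s ^ 3` are strictly monotone, with derivatives `1 + 3 s ^ 2`
and `-1 - 6 s ^ 2`. Their linear parts cancel, and the sum `-s ^ 3` has a degenerate critical point
at `0`. -/
theorem exists_bottleneck_mem_classC3 {d k : ℕ} (hk : 2 ≤ k) (hd : 1 ≤ d) :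
    ∃ (A : MLPArch) (P : A.Params) (θ : A.Weights),
      A.width 0 = d ∧ A.IsBottleneck ∧ BottleneckWidths A.width ∧
      P.IsAdmissible k ∧ P.IsNonlinear ∧ θ.IsFullRank ∧ A.map P θ ∈ classC3 k (A.width 0) := by
  have hcub : ∀ a b s : ℝ, HasDerivAt (fun s : ℝ => a * s + b * s ^ 3) (a + b * (3 * s ^ 2)) s :=
    fun a b s => by
      simpa using ((hasDerivAt_id s).const_mul a).fun_add ((hasDerivAt_pow 3 s).const_mul b)
  have hg : (fun s : ℝ => (1 * s + 1 * s ^ 3) + (-1 * s + -2 * s ^ 3)) = fun s => -s ^ 3 :=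
    funext fun s => by ring
  refine exists_bottleneck_mem_class hd (classC3 k) (σ := fun s => 1 * s + 1 * s ^ 3)
    (τ := fun s => -1 * s + -2 * s ^ 3) (by fun_prop) (fun s => by
      rw [(hcub _ _ s).deriv]
      positivity) (by fun_prop) (fun s => by
      rw [(hcub _ _ s).deriv]
      nlinarith [sq_nonneg s]) (not_affine_cubic one_ne_zero) (not_affine_cubic (by norm_num))
      fun hc => ?_
  have hg1 : deriv (fun s : ℝ => (1 * s + 1 * s ^ 3) + (-1 * s + -2 * s ^ 3)) =
      fun s => -(3 * s ^ 2) := by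
    rw [hg]
    ext s
    simp
  have h0 : ∀ i : Fin d, deriv (fun s : ℝ => (1 * s + 1 * s ^ 3) + (-1 * s + -2 * s ^ 3))
      ((0 : EuclideanSpace ℝ (Fin d)) i) = 0 := fun i => by
    rw [hg1]
    simp
  refine mem_classC3_of hk hc (x := 0) (v := EuclideanSpace.single ⟨0, hd⟩ 1)
    ((fderiv_expTower_separable_eq_zero_iff (by fun_prop) 0).2 h0) (by simp) ?_
  ext v
  have h1 := fderiv_fderiv_expTower_separable
    (g := fun s : ℝ => (1 * s + 1 * s ^ 3) + (-1 * s + -2 * s ^ 3)) (by fun_prop) h0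
    (EuclideanSpace.single ⟨0, hd⟩ 1) v
  rw [h1, hg1]
  simp

end MLPArch

theorem mainTheorem2 :
    -- non-augmented MLPs
    (∀ (k : ℕ), 1 ≤ k → ∀ (A : MLPArch) (P : A.Params), P.IsAdmissible k → A.IsNonAugmented →
      ∀ θ : A.Weights, θ.IsFullRank → A.map P θ ∈ classC1 k (A.width 0)) ∧
    -- augmented MLPs
    (∀ (k : ℕ), 2 ≤ k → ∀ (A : MLPArch) (P : A.Params), P.IsAdmissible k → A.IsAugmented →
      ∀ᵐ θ : A.Weights, A.map P θ ∈ classC1 k (A.width 0) ∪ classC2 k (A.width 0)) ∧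
    -- MLPs with a bottleneck
    (∀ (k : ℕ), 2 ≤ k →
      (∀ (A : MLPArch) (P : A.Params), P.IsAdmissible k → A.IsBottleneck →
        ∀ θ : A.Weights, θ.IsFullRank →
          A.map P θ ∈ classC1 k (A.width 0) ∪ classC2 k (A.width 0) ∪ classC3 k (A.width 0)) ∧
      ∀ (d : ℕ), 1 ≤ d → ∀ C ∈ ({classC1 k, classC2 k, classC3 k} :
          Set (∀ n : ℕ, Set (EuclideanSpace ℝ (Fin n) → ℝ))),
        ∃ (A : MLPArch) (P : A.Params) (θ : A.Weights),
          A.width 0 = d ∧ A.IsBottleneck ∧ BottleneckWidths A.width ∧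
          P.IsAdmissible k ∧ P.IsNonlinear ∧ θ.IsFullRank ∧ A.map P θ ∈ C (A.width 0)) ∧
    -- non-augmented neural ODEs
    (∀ (k d m : ℕ), 1 ≤ k → 1 ≤ d → 1 ≤ m → m ≤ max d 1 →
      ∀ (T : ℝ), 0 < T → ∀ f : ℝ → (Fin m → ℝ) → (Fin m → ℝ), IsC0kVectorField k T f →
      ∀ (W : Matrix (Fin m) (Fin d) ℝ) (b : Fin m → ℝ)
        (W' : Matrix (Fin 1) (Fin m) ℝ) (b' : Fin 1 → ℝ), FullRank W → FullRank W' →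
      ∀ Φ, IsNeuralODEMap T f W b W' b' Φ → Φ ∈ classC1 k d) ∧
    -- augmented neural ODEs
    (∀ (k d m : ℕ), 2 ≤ k → 1 ≤ d → max d 1 < m →
      ∀ (T : ℝ), 0 < T → ∀ f : ℝ → (Fin m → ℝ) → (Fin m → ℝ), IsC0kVectorField k T f →
      ∀ (b : Fin m → ℝ) (b' : Fin 1 → ℝ),
      ∀ᵐ V : (Fin m → Fin d → ℝ) × (Fin 1 → Fin m → ℝ),
      ∀ Φ, IsNeuralODEMap T f (Matrix.of V.1) b (Matrix.of V.2) b' Φ →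
        Φ ∈ classC1 k d ∪ classC2 k d) ∧
    -- degenerate neural ODEs
    (∀ (k d m : ℕ), 2 ≤ k → 1 ≤ d → 1 ≤ m →
      ∀ (T : ℝ), 0 < T → ∀ f : ℝ → (Fin m → ℝ) → (Fin m → ℝ), IsC0kVectorField k T f →
      ∀ (W : Matrix (Fin m) (Fin d) ℝ) (b : Fin m → ℝ)
        (W' : Matrix (Fin 1) (Fin m) ℝ) (b' : Fin 1 → ℝ), ¬ FullRank W ∨ ¬ FullRank W' →
      ∀ Φ, IsNeuralODEMap T f W b W' b' Φ → Φ ∈ classC1 k d ∪ classC3 k d) := by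
  refine ⟨fun k hk A P hP hA θ hθ => MLPArch.map_mem_classC1 hk hP hA hθ,
    fun k hk A P hP hA => MLPArch.ae_map_mem_classC1_union_classC2 hk hP hA,
    fun k hk => ⟨fun A P hP _ θ _ =>
      mem_classC1_union_classC2_union_classC3 (MLPArch.contDiff_map hP θ), ?_⟩,
    fun k d m hk hd hm hmd T hT f hf W b W' b' hW hW' Φ hΦ =>
      neuralODE_mem_classC1 hk hm (by omega) hT.le hf hW hW' hΦ,
    fun k d m hk _ hmd T hT f hf b b' =>
      ae_neuralODE_mem_classC1_union_classC2 hk (by omega) hT.le hf b b',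
    fun k d m hk hd hm T hT f hf W b W' b' hW Φ hΦ =>
      degenerate_neuralODE_mem_classC1_union_classC3 hk hd hm hT.le hf hW hΦ⟩
  rintro d hd C (rfl | rfl | rfl)
  · exact MLPArch.exists_bottleneck_mem_classC1 hd
  · exact MLPArch.exists_bottleneck_mem_classC2 hk hd
  · exact MLPArch.exists_bottleneck_mem_classC3 hk hd
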